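/- Let $\Gamma$ be a group with identity $e$ and let $R=\bigoplus_{\gamma\in\Gamma}R_\gamma$ be a nonzero $\Gamma$-graded associative ring with $1$. An element is homogeneous if it lies in some $R_\gamma$. A $\Gamma$-graded domain is a nonzero $\Gamma$-graded ring in which a product of two nonzero homogeneous elements is nonzero; a $\Gamma$-graded division ring is a nonzero $\Gamma$-graded ring in which every nonzero homogeneous element is invertible. A $\Gamma$-graded epic $R$-division ring is a pair $(K,\varphi)$ where $K$ is a $\Gamma$-graded division ring and $\varphi\colon R\to K$ is a homomorphism of $\Gamma$-graded rings such that $K$ is generated as a graded division ring by $\varphi(R)$, i.e. every element of $K$ is a sum of elements obtained from the homogeneous elements of $\varphi(R)$ by repeatedly taking sums and differences of elements of equal degree, products, and inverses. It is called a $\Gamma$-graded epic $R$-division ring of fractions if $\varphi$ is injective (equivalently, $\varphi(x)\ne0$ for every nonzero homogeneous $x\in R$). A $\Gamma$-almost graded ring is a ring $E$ with additive subgroups $(E_\gamma)_{\gamma\in\Gamma}$ such that $1\in E_e$, $E_\gamma E_\delta\subseteq E_{\gamma\delta}$ and $E=\sum_\gamma E_\gamma$ (the sum need not be direct). It is a $\Gamma$-almost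 graded division ring if $E\neq 0$ and every nonzero $x\in E_\gamma$ is invertible with $x^{-1}\in E_{\gamma^{-1}}$. A homomorphism of $\Gamma$-almost graded rings is a ring homomorphism $f$ that maps the component of degree $\gamma$ into the component of degree $\gamma$ for each $\gamma\in\Gamma$. For $\overline\alpha\in\Gamma^m$, $\overline\beta\in\Gamma^n$ let $M_{m\times n}(R)[\overline\alpha][\overline\beta]$ be the set of $m\times n$ matrices whose $(i,j)$ entry lies in $R_{\alpha_i\beta_j^{-1}}$; a matrix is homogeneous if it lies in one of these sets. A homogeneous $n\times n$ matrix $A$ is gr-full if $r\ge n$ whenever $A=PQ$ with $P\in M_{n\times r}(R)[\overline\alpha][\overline\lambda]$ and $Q\in M_{r\times n}(R)[\overline\lambda][\overline\beta]$ for some $\overline\alpha,\overline\beta\in\Gamma^n$, $\overline\lambda\in\Gamma^r$. Let $\mathcal N$ be the set of homogeneous square matrices over $R$ that are not gr-full. If $A,B$ lie in the same $M_{n\times n}(R)[\overline\alpha][\overline\beta]$ and differ at most in the $i$-th column (respectively row), their determinantal sum $A\nabla B$ with respect to that column (row) is the matrix obtained from $A$ by replacing its $i$-th column (row) by the sum of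 the $i$-th columns (rows) of $A$ and $B$. A matrix $C$ is a determinantal sum of matrices of $\mathcal N$ if there are $m\ge1$ and $A_1,\dots,A_m\in\mathcal N$ such that $A_1\nabla A_2\nabla\cdots\nabla A_m$ exists for some choice of parentheses (and of rows and columns) and equals $C$. **Theorem.** The following assertions are equivalent. 1. There exists a $\Gamma$-graded epic $R$-division ring of fractions $(K,\varphi)$. 2. There exists a homomorphism of $\Gamma$-almost graded rings $\varphi\colon R\to K$, with $K$ a $\Gamma$-almost graded division ring, such that $\varphi(x)\neq0$ for each nonzero homogeneous $x\in R$. 3. $R$ is a $\Gamma$-graded domain and no matrix of the form $aI$ with $a\in R$ nonzero homogeneous and $I$ an identity matrix is a determinantal sum of matrices of $\mathcal N$. 4. No diagonal matrix whose diagonal entries are all nonzero homogeneous elements of $R$ is a determinantal sum of matrices of $\mathcal N$. -/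

import Mathlib

/-!
Throughout, the grading group `Γ` is an arbitrary, possibly noncommutative, group. Following
Mathlib's `GradedRing`, it is written additively: `γ + δ` stands for the product `γδ`, `0` for the
identity `e`, `-γ` for `γ⁻¹` and `γ - δ = γ + -δ` for `γδ⁻¹`.
-/

universe u v w

namespace GrMat

section Rings

variable {Γ : Type v} [AddGroup Γ] {S : Type u} [Ring S]

/-- A graded domain: a nonzero graded ring in which the product of two nonzero homogeneous
elements is nonzero. -/
structure IsGradedDomain (𝒮 : Γ → AddSubgroup S) : Prop where
  nontrivial : Nontrivial S
  eq_zero_or_eq_zero_of_mul_eq_zero : ∀ x y : S, SetLike.IsHomogeneousElem 𝒮 x →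
    SetLike.IsHomogeneousElem 𝒮 y → x * y = 0 → x = 0 ∨ y = 0

/-- A graded division ring: a nonzero graded ring in which every nonzero homogeneous element
is invertible. -/
structure IsGradedDivisionRing (𝒮 : Γ → AddSubgroup S) : Prop where
  nontrivial : Nontrivial S
  isUnit_of_ne_zero : ∀ x : S, SetLike.IsHomogeneousElem 𝒮 x → x ≠ 0 → IsUnit x

/-- An almost graded ring: `1 ∈ S_e`, `S_γ S_δ ⊆ S_{γδ}`, and `S` is the (not necessarily
direct) sum of the additive subgroups `S_γ`. -/
structure IsAlmostGradedRing (𝒮 : Γ → AddSubgroup S) : Prop where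
  gradedMonoid : SetLike.GradedMonoid 𝒮
  iSup_eq_top : ⨆ γ, 𝒮 γ = ⊤

/-- An almost graded division ring: a nonzero almost graded ring in which every nonzero element
of `S_γ` is invertible with inverse in `S_{γ⁻¹}`. -/
structure IsAlmostGradedDivisionRing (𝒮 : Γ → AddSubgroup S) : Prop
    extends IsAlmostGradedRing 𝒮 where
  nontrivial : Nontrivial S
  exists_inv : ∀ (γ : Γ) (x : S), x ∈ 𝒮 γ → x ≠ 0 → ∃ y ∈ 𝒮 (-γ), x * y = 1 ∧ y * x = 1

/-- `InDivisionClosure 𝒜 f γ x` says that `x` lies in the component of degree `γ` of the division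
closure of `f : R → S`: the components are obtained from the images `f(R_γ)` by repeatedly
forming sums, differences, products (degrees multiply), and inverses of elements that are
invertible in `S` (the degree is inverted). -/
inductive InDivisionClosure {R : Type*} [Ring R] (𝒜 : Γ → AddSubgroup R) (f : R →+* S) :
    Γ → S → Prop
  | map {γ : Γ} {r : R} : r ∈ 𝒜 γ → InDivisionClosure 𝒜 f γ (f r)
  | add {γ : Γ} {x y : S} : InDivisionClosure 𝒜 f γ x → InDivisionClosure 𝒜 f γ y →
      InDivisionClosure 𝒜 f γ (x + y)
  | neg {γ : Γ} {x : S} : InDivisionClosure 𝒜 f γ x → InDivisionClosure 𝒜 f γ (-x)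
  | mul {γ δ : Γ} {x y : S} : InDivisionClosure 𝒜 f γ x → InDivisionClosure 𝒜 f δ y →
      InDivisionClosure 𝒜 f (γ + δ) (x * y)
  | inv {γ : Γ} {x y : S} : InDivisionClosure 𝒜 f γ x → x * y = 1 → y * x = 1 →
      InDivisionClosure 𝒜 f (-γ) y

/-- The division closure `DC(f)`: the additive subgroup of `S` generated by its components. -/
def divisionClosure {R : Type*} [Ring R] (𝒜 : Γ → AddSubgroup R) (f : R →+* S) :
    AddSubgroup S :=
  AddSubgroup.closure {x | ∃ γ, InDivisionClosure 𝒜 f γ x}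

/-- `(S, φ)` is a graded epic `R`-division ring: `S` is a graded division ring, generated as a
graded division ring by the image of the graded ring homomorphism `φ : R → S`. -/
structure IsGradedEpicDivisionRing {R : Type*} [Ring R] (𝒜 : Γ → AddSubgroup R)
    (𝒮 : Γ → AddSubgroup S) (φ : 𝒜 →+*ᵍ 𝒮) : Prop where
  isGradedDivisionRing : IsGradedDivisionRing 𝒮
  divisionClosure_eq_top : divisionClosure 𝒜 φ.toRingHom = ⊤

end Rings

section Matrices

variable {Γ : Type v} [AddGroup Γ] {R : Type u} [Ring R] (𝒜 : Γ → AddSubgroup R)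

/-- `A ∈ M_{m×n}(R)[α][β]`: the `(i, j)` entry of `A` lies in `R_{α_i β_j⁻¹}`. -/
def HasDegrees {m n : ℕ} (α : Fin m → Γ) (β : Fin n → Γ) (A : Matrix (Fin m) (Fin n) R) : Prop :=
  ∀ i j, A i j ∈ 𝒜 (α i - β j)

/-- `A` is a homogeneous square matrix. -/
def IsHomogeneousMatrix {n : ℕ} (A : Matrix (Fin n) (Fin n) R) : Prop :=
  ∃ α β : Fin n → Γ, HasDegrees 𝒜 α β A

/-- `A` is gr-full: in every factorization `A = PQ` with `P ∈ M_{n×r}(R)[α][ε]` and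
`Q ∈ M_{r×n}(R)[ε][β]` one has `r ≥ n`. -/
def IsGrFull {n : ℕ} (A : Matrix (Fin n) (Fin n) R) : Prop :=
  ∀ (r : ℕ) (α β : Fin n → Γ) (ε : Fin r → Γ)
    (P : Matrix (Fin n) (Fin r) R) (Q : Matrix (Fin r) (Fin n) R),
    HasDegrees 𝒜 α ε P → HasDegrees 𝒜 ε β Q → A = P * Q → n ≤ r

/-- The set `𝒩` of the `n × n` homogeneous matrices that are not gr-full. -/
def nonGrFull (n : ℕ) : Set (Matrix (Fin n) (Fin n) R) :=
  {A | IsHomogeneousMatrix 𝒜 A ∧ ¬ IsGrFull 𝒜 A}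

/-- `C` is the determinantal sum `A ∇ B` with respect to some column or some row: `A` and `B`
belong to the same `M_n(R)[α][β]`, they differ at most in that column (row), and `C` arises from
`A` by adding to that column (row) the one of `B`. -/
def IsNabla {n : ℕ} (A B C : Matrix (Fin n) (Fin n) R) : Prop :=
  (∃ α β : Fin n → Γ, HasDegrees 𝒜 α β A ∧ HasDegrees 𝒜 α β B) ∧
  ((∃ j, (∀ i k, k ≠ j → A i k = B i k) ∧ C = A.updateCol j (fun i => A i j + B i j)) ∨
   (∃ i, (∀ k j, k ≠ i → A k j = B k j) ∧ C = A.updateRow i (fun j => A i j + B i j)))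

/-- `C` is a determinantal sum of elements of `W`: it equals `A₁ ∇ A₂ ∇ ⋯ ∇ A_m` with `m ≥ 1` and
`A₁, …, A_m ∈ W`, for some choice of parentheses (and of rows or columns). -/
inductive IsDeterminantalSum {n : ℕ} (W : Set (Matrix (Fin n) (Fin n) R)) :
    Matrix (Fin n) (Fin n) R → Prop
  | of_mem {A : Matrix (Fin n) (Fin n) R} : A ∈ W → IsDeterminantalSum W A
  | nabla {A B C : Matrix (Fin n) (Fin n) R} : IsDeterminantalSum W A →
      IsDeterminantalSum W B → IsNabla 𝒜 A B C → IsDeterminantalSum W C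

end Matrices

end GrMat

/-! The theorem is a graded form of Cohn's description of homomorphisms to division rings by the
matrices that become singular.

Over an almost graded division ring, homogeneous Gaussian elimination works, so a homogeneous square
matrix is invertible or kills a nonzero vector. A matrix that factors through a smaller size becomes
singular, and a determinantal sum of singular matrices is singular (`not_isUnit_of_isNabla`),
whereas a diagonal matrix with nonzero homogeneous entries becomes invertible. This proves 4 from 2.
For 3 from 4, a relation `xy = 0` exhibits `diag(x, y)` as a determinantal sum of two matrices that
are not gr-full.

For 1 from 3, Zorn's lemma gives a matrix ideal `P` maximal among those containing no `aI` with `a`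
nonzero homogeneous. Maximality and the domain property make `P` prime: a diagonal sum lies in `P`
only if a summand does. The members of `P` are to become singular, so elements of the division ring
are classes of formal expressions `f A⁻¹ x` with `A ∉ P`. The matrix `(A x; f 0)` has Schur
complement `-f A⁻¹ x`, so the expression counts as zero when this bordered matrix lies in `P`. Sums
use block diagonal denominators. The product of `f A⁻¹ x` and `g B⁻¹ y` uses `(A, -xg; 0, B)`, whose
inverse has upper right block `A⁻¹ x g B⁻¹`. The lower right entry of the inverse of the bordered
matrix is `-(f A⁻¹ x)⁻¹`, so a nonzero expression has an inverse. Nearly all ring axioms follow from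
one criterion for equality, `rel_of_intertwine`.

Finally, the external direct sum of the components of the division closure turns any almost graded
solution into a graded epic one, and counting rational expressions settles its universe. -/

namespace GrMat

/-! ### Homogeneous matrices, matrix ideals and the existence of a prime one -/

section Degrees

variable {Γ : Type v} [AddGroup Γ] {R : Type u} [Ring R] (𝒜 : Γ → AddSubgroup R)

/-- The `(i, j)` entry of `A` lies in `R_{α_i β_j⁻¹}`, for matrices with arbitrary index types. -/
def HasDeg {m n : Type*} (α : m → Γ) (β : n → Γ) (A : Matrix m n R) : Prop :=
  ∀ i j, A i j ∈ 𝒜 (α i - β j)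

variable {𝒜} {l m n p : Type*} {α : l → Γ} {β : m → Γ} {γ : n → Γ} {δ : p → Γ}

@[simp] theorem hasDeg_zero : HasDeg 𝒜 α β 0 := fun _ _ => zero_mem _

theorem HasDeg.neg {A : Matrix l m R} (h : HasDeg 𝒜 α β A) : HasDeg 𝒜 α β (-A) :=
  fun i j => neg_mem (h i j)

@[simp] theorem hasDeg_neg {A : Matrix l m R} : HasDeg 𝒜 α β (-A) ↔ HasDeg 𝒜 α β A :=
  ⟨fun h => by simpa using h.neg, HasDeg.neg⟩

theorem HasDeg.add {A B : Matrix l m R} (h : HasDeg 𝒜 α β A) (h' : HasDeg 𝒜 α β B) :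
    HasDeg 𝒜 α β (A + B) :=
  fun i j => add_mem (h i j) (h' i j)

theorem HasDeg.mul [SetLike.GradedMonoid 𝒜] [Fintype m] {A : Matrix l m R} {B : Matrix m n R}
    (h : HasDeg 𝒜 α β A) (h' : HasDeg 𝒜 β γ B) : HasDeg 𝒜 α γ (A * B) := fun i j => by
  rw [Matrix.mul_apply]
  refine sum_mem fun k _ => ?_
  rw [← sub_add_sub_cancel _ (β k)]
  exact SetLike.mul_mem_graded (h i k) (h' k j)

@[simp] theorem hasDeg_one [SetLike.GradedMonoid 𝒜] [DecidableEq l] :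
    HasDeg 𝒜 α α (1 : Matrix l l R) := fun i j => by
  by_cases h : i = j
  · subst h
    simpa using SetLike.one_mem_graded 𝒜
  · simp [Matrix.one_apply_ne h]

theorem HasDeg.submatrix {A : Matrix l m R} (h : HasDeg 𝒜 α β A) (e : n → l) (f : p → m) :
    HasDeg 𝒜 (α ∘ e) (β ∘ f) (A.submatrix e f) := fun i j => h (e i) (f j)

theorem HasDeg.add_right {A : Matrix l m R} (h : HasDeg 𝒜 α β A) (τ : Γ) :
    HasDeg 𝒜 (fun i => α i + τ) (fun j => β j + τ) A := fun i j => by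
  simpa using h i j

@[simp] theorem hasDeg_fromBlocks {A : Matrix l n R} {B : Matrix l p R} {C : Matrix m n R}
    {D : Matrix m p R} :
    HasDeg 𝒜 (Sum.elim α β) (Sum.elim γ δ) (Matrix.fromBlocks A B C D) ↔
      (HasDeg 𝒜 α γ A ∧ HasDeg 𝒜 α δ B) ∧ HasDeg 𝒜 β γ C ∧ HasDeg 𝒜 β δ D := by
  simp only [HasDeg, Sum.forall, forall_and, Sum.elim_inl, Sum.elim_inr, Matrix.fromBlocks_apply₁₁,
    Matrix.fromBlocks_apply₁₂, Matrix.fromBlocks_apply₂₁, Matrix.fromBlocks_apply₂₂]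
  tauto

@[simp] theorem hasDeg_fromRows {A : Matrix l n R} {B : Matrix m n R} :
    HasDeg 𝒜 (Sum.elim α β) γ (Matrix.fromRows A B) ↔ HasDeg 𝒜 α γ A ∧ HasDeg 𝒜 β γ B := by
  simp [HasDeg, Sum.forall]

@[simp] theorem hasDeg_fromCols {A : Matrix l m R} {B : Matrix l n R} :
    HasDeg 𝒜 α (Sum.elim β γ) (Matrix.fromCols A B) ↔ HasDeg 𝒜 α β A ∧ HasDeg 𝒜 α γ B := by
  simp [HasDeg, Sum.forall, forall_and]

variable (𝒜)

/-- A square matrix that is homogeneous for some choice of degrees. -/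
def IsHom {ι : Type*} (A : Matrix ι ι R) : Prop := ∃ α β : ι → Γ, HasDeg 𝒜 α β A

/-- A matrix over a finite index type with a homogeneous factorization through a smaller one. -/
def NonFull {ι : Type} (A : Matrix ι ι R) : Prop :=
  ∃ (κ : Type) (_ : Fintype κ) (α β : ι → Γ) (ε : κ → Γ) (X : Matrix ι κ R) (Y : Matrix κ ι R),
    Fintype.card κ < Nat.card ι ∧ HasDeg 𝒜 α ε X ∧ HasDeg 𝒜 ε β Y ∧ A = X * Y

/-- Iterated determinantal sums, with respect to columns, of matrices that are not full. -/
inductive DetSum : ∀ ι : Type, Matrix ι ι R → Prop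
  | of_nonFull {ι : Type} {A : Matrix ι ι R} : NonFull 𝒜 A → DetSum ι A
  | nabla {ι : Type} {A B C : Matrix ι ι R} (j : ι) (α β : ι → Γ) :
      DetSum ι A → DetSum ι B → HasDeg 𝒜 α β A → HasDeg 𝒜 α β B →
      (∀ i, C i j = A i j + B i j) → (∀ i k, k ≠ j → C i k = A i k ∧ C i k = B i k) → DetSum ι C

/-- A family of sets of homogeneous square matrices that contains the matrices which are not full
and is closed under determinantal sums with respect to columns, diagonal sums with homogeneous
matrices, permutations of rows and columns, and products with diagonal matrices. -/
structure MatrixIdeal (P : ∀ ι : Type, Matrix ι ι R → Prop) : Prop where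
  isHom : ∀ {ι : Type} {A : Matrix ι ι R}, P ι A → IsHom 𝒜 A
  nonFull : ∀ {ι : Type} {A : Matrix ι ι R}, NonFull 𝒜 A → P ι A
  nabla : ∀ {ι : Type} {A B C : Matrix ι ι R} (j : ι) (α β : ι → Γ), P ι A → P ι B →
    HasDeg 𝒜 α β A → HasDeg 𝒜 α β B → (∀ i, C i j = A i j + B i j) →
    (∀ i k, k ≠ j → C i k = A i k ∧ C i k = B i k) → P ι C
  sum : ∀ {ι κ : Type} [Finite κ] {A : Matrix ι ι R} {B : Matrix κ κ R}, P ι A → IsHom 𝒜 B →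
    P (ι ⊕ κ) (Matrix.fromBlocks A 0 0 B)
  reindex : ∀ {ι κ : Type} {A : Matrix ι ι R} (e f : κ ≃ ι), P ι A → P κ (A.submatrix e f)
  mul_diag : ∀ {ι : Type} {A : Matrix ι ι R} (d : ι → R),
    (∀ i, SetLike.IsHomogeneousElem 𝒜 (d i)) → P ι A → P ι (Matrix.of fun i j => A i j * d j)
  diag_mul : ∀ {ι : Type} {A : Matrix ι ι R} (d : ι → R),
    (∀ i, SetLike.IsHomogeneousElem 𝒜 (d i)) → P ι A → P ι (Matrix.of fun i j => d i * A i j)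

/-- No scalar matrix `aI` with `a` nonzero homogeneous belongs to `P`. -/
def ProperFamily (P : ∀ ι : Type, Matrix ι ι R → Prop) : Prop :=
  ∀ (ι : Type) [Finite ι] [DecidableEq ι] (a : R), SetLike.IsHomogeneousElem 𝒜 a → a ≠ 0 →
    ¬ P ι (a • (1 : Matrix ι ι R))

variable {𝒜}

theorem IsHom.nabla {ι : Type} {A B C : Matrix ι ι R} {j : ι} {α β : ι → Γ}
    (hA : HasDeg 𝒜 α β A) (hB : HasDeg 𝒜 α β B) (hj : ∀ i, C i j = A i j + B i j)
    (hk : ∀ i k, k ≠ j → C i k = A i k ∧ C i k = B i k) : HasDeg 𝒜 α β C := fun i k => by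
  by_cases h : k = j
  · subst h
    rw [hj]
    exact add_mem (hA _ _) (hB _ _)
  · rw [(hk i k h).1]
    exact hA _ _

theorem IsHom.fromBlocks {ι κ : Type} {A : Matrix ι ι R} {B : Matrix κ κ R} (hA : IsHom 𝒜 A)
    (hB : IsHom 𝒜 B) : IsHom 𝒜 (Matrix.fromBlocks A 0 0 B) := by
  obtain ⟨α, β, hA⟩ := hA
  obtain ⟨α', β', hB⟩ := hB
  exact ⟨Sum.elim α α', Sum.elim β β', by simp [hA, hB]⟩

theorem HasDeg.mul_diag [SetLike.GradedMonoid 𝒜] {A : Matrix l m R} (hA : HasDeg 𝒜 α β A)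
    {d : m → R} {γ : m → Γ} (hd : ∀ j, d j ∈ 𝒜 (γ j)) :
    HasDeg 𝒜 α (fun j => -γ j + β j) (Matrix.of fun i j => A i j * d j) := fun i j => by
  have := SetLike.mul_mem_graded (hA i j) (hd j)
  simpa [sub_eq_add_neg, add_assoc] using this

theorem HasDeg.diag_mul [SetLike.GradedMonoid 𝒜] {A : Matrix l m R} (hA : HasDeg 𝒜 α β A)
    {d : l → R} {γ : l → Γ} (hd : ∀ i, d i ∈ 𝒜 (γ i)) :
    HasDeg 𝒜 (fun i => γ i + α i) β (Matrix.of fun i j => d i * A i j) := fun i j => by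
  have := SetLike.mul_mem_graded (hd i) (hA i j)
  simpa [sub_eq_add_neg, add_assoc] using this

/-- An infinite index type has `Nat.card` equal to `0`, which leaves no room for a smaller
factorization. -/
theorem DetSum.finite {ι : Type} {A : Matrix ι ι R} (h : DetSum 𝒜 ι A) : Finite ι := by
  induction h with
  | of_nonFull h =>
    obtain ⟨κ, _, α, β, ε, X, Y, hc, -⟩ := h
    exact Nat.finite_of_card_ne_zero (by omega)
  | nabla _ _ _ _ _ _ _ _ _ ih _ => exact ih

/-- All the operations respect column sums, so each closure property reduces to one about
factorizations. This is the least matrix ideal and the starting point for Zorn's lemma. -/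
theorem matrixIdeal_detSum [SetLike.GradedMonoid 𝒜] : MatrixIdeal 𝒜 (DetSum 𝒜) where
  isHom h := by
    induction h with
    | of_nonFull h =>
      obtain ⟨κ, _, α, β, ε, X, Y, hc, hX, hY, rfl⟩ := h
      exact ⟨α, β, hX.mul hY⟩
    | nabla j α β _ _ hA hB h1 h2 _ _ => exact ⟨α, β, IsHom.nabla hA hB h1 h2⟩
  nonFull h := .of_nonFull h
  nabla j α β hA hB h1 h2 h3 h4 := .nabla j α β hA hB h1 h2 h3 h4
  sum {ι κ} _ A B h hB := by
    obtain ⟨α', β', hB⟩ := hB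
    induction h with
    | of_nonFull h =>
      have := (DetSum.of_nonFull h).finite
      obtain ⟨μ, _, α, β, ε, X, Y, hc, hX, hY, rfl⟩ := h
      classical
      have := Fintype.ofFinite κ
      refine .of_nonFull ⟨μ ⊕ κ, inferInstance, Sum.elim α α', Sum.elim β β', Sum.elim ε α',
        Matrix.fromBlocks X 0 0 1, Matrix.fromBlocks Y 0 0 B, ?_, by simp [hX], by simp [hY, hB], ?_⟩
      · rw [Nat.card_sum, Fintype.card_sum, Nat.card_eq_fintype_card (α := κ)]
        omega
      · simp [Matrix.fromBlocks_multiply]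
    | nabla j α β _ _ hA hB' h1 h2 ih1 ih2 =>
      refine .nabla (Sum.inl j) (Sum.elim α α') (Sum.elim β β') ih1 ih2
        (by simp [hA, hB]) (by simp [hB', hB]) ?_ ?_
      · simp [Sum.forall, h1]
      · rintro (i | i) (k | k) hk
        · simpa using h2 i k (by simpa using hk)
        all_goals simp
  reindex {ι κ A} e f h := by
    induction h with
    | of_nonFull h =>
      obtain ⟨μ, _, α, β, ε, X, Y, hc, hX, hY, rfl⟩ := h
      refine .of_nonFull ⟨μ, inferInstance, α ∘ e, β ∘ f, ε, X.submatrix e id, Y.submatrix id f,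
        by rwa [Nat.card_congr e], fun i j => hX _ _, fun i j => hY _ _, ?_⟩
      ext i j
      simp [Matrix.mul_apply]
    | nabla j α β _ _ hA hB h1 h2 ih1 ih2 =>
      refine .nabla (f.symm j) (α ∘ e) (β ∘ f) ih1 ih2
        (hA.submatrix _ _) (hB.submatrix _ _) (by simp [h1]) fun i k hk => h2 _ _ ?_
      rintro rfl
      simp at hk
  mul_diag d hd h := by
    choose δ hd using hd
    induction h with
    | of_nonFull h =>
      obtain ⟨μ, _, α, β, ε, X, Y, hc, hX, hY, rfl⟩ := h
      refine .of_nonFull ⟨μ, inferInstance, α, _, ε, X, _, hc, hX, hY.mul_diag hd, ?_⟩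
      ext i j
      simp [Matrix.mul_apply, Finset.sum_mul, mul_assoc]
    | nabla j α β _ _ hA hB h1 h2 ih1 ih2 =>
      refine .nabla j _ _ ih1 ih2 (hA.mul_diag hd) (hB.mul_diag hd)
        (by simp [h1, add_mul]) fun i k hk => ?_
      simp only [Matrix.of_apply]
      rw [← (h2 i k hk).1, ← (h2 i k hk).2]
      simp
  diag_mul d hd h := by
    choose δ hd using hd
    induction h with
    | of_nonFull h =>
      obtain ⟨μ, _, α, β, ε, X, Y, hc, hX, hY, rfl⟩ := h
      refine .of_nonFull ⟨μ, inferInstance, _, β, ε, _, Y, hc, hX.diag_mul hd, hY, ?_⟩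
      ext i j
      simp [Matrix.mul_apply, Finset.mul_sum, mul_assoc]
    | nabla j α β _ _ hA hB h1 h2 ih1 ih2 =>
      refine .nabla j _ _ ih1 ih2 (hA.diag_mul hd) (hB.diag_mul hd)
        (by simp [h1, mul_add]) fun i k hk => ?_
      simp only [Matrix.of_apply]
      rw [← (h2 i k hk).1, ← (h2 i k hk).2]
      simp

/-- The square matrices whose diagonal sum with `B` lies in `P` form a matrix ideal. -/
theorem MatrixIdeal.quotient [SetLike.GradedMonoid 𝒜] {P : ∀ ι : Type, Matrix ι ι R → Prop}
    (hP : MatrixIdeal 𝒜 P) {κ : Type} [Finite κ] {B : Matrix κ κ R} (hB : IsHom 𝒜 B) :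
    MatrixIdeal 𝒜 fun ι A => P (ι ⊕ κ) (Matrix.fromBlocks A 0 0 B) where
  isHom h := by
    obtain ⟨α, β, h⟩ := hP.isHom h
    exact ⟨α ∘ Sum.inl, β ∘ Sum.inl, fun i j => h (Sum.inl i) (Sum.inl j)⟩
  nonFull h := hP.sum (hP.nonFull h) hB
  nabla j α β hA hB' h1 h2 h3 h4 := by
    obtain ⟨α', β', hB⟩ := hB
    refine hP.nabla (Sum.inl j) (Sum.elim α α') (Sum.elim β β') hA hB' (by simp [h1, hB])
      (by simp [h2, hB]) ?_ ?_
    · simp [Sum.forall, h3]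
    · simp +contextual [Sum.forall, ← h4]
  sum {ι μ} _ A C hA hC := by
    have := hP.reindex ((Equiv.sumAssoc ι μ κ).trans (((Equiv.refl ι).sumCongr
      (Equiv.sumComm μ κ)).trans (Equiv.sumAssoc ι κ μ).symm)) ((Equiv.sumAssoc ι μ κ).trans (((Equiv.refl ι).sumCongr
      (Equiv.sumComm μ κ)).trans (Equiv.sumAssoc ι κ μ).symm)) (hP.sum hA hC)
    convert this using 1
    ext ((i | i) | i) ((j | j) | j) <;> simp
  reindex {ι κ A} e f h := by
    convert hP.reindex (e.sumCongr (Equiv.refl _)) (f.sumCongr (Equiv.refl _)) h using 1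
    ext (i | i) (j | j) <;> simp
  mul_diag d hd h := by
    convert hP.mul_diag (Sum.elim d fun _ => 1)
      (Sum.forall.2 ⟨hd, fun _ => SetLike.isHomogeneousElem_one 𝒜⟩) h using 1
    ext (i | i) (j | j) <;> simp
  diag_mul d hd h := by
    convert hP.diag_mul (Sum.elim d fun _ => 1)
      (Sum.forall.2 ⟨hd, fun _ => SetLike.isHomogeneousElem_one 𝒜⟩) h using 1
    ext (i | i) (j | j) <;> simp

/-- Each closure condition involves at most two members of the family, so it passes to the union of
a chain. -/
theorem MatrixIdeal.exists_maximal [SetLike.GradedMonoid 𝒜] (h : ProperFamily 𝒜 (DetSum 𝒜)) :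
    ∃ P, Maximal (fun P => MatrixIdeal 𝒜 P ∧ ProperFamily 𝒜 P) P := by
  suffices H : ∀ c ⊆ {P | MatrixIdeal 𝒜 P ∧ ProperFamily 𝒜 P}, IsChain (· ≤ ·) c →
      ∀ P₀ ∈ c, ∃ P ∈ {P | MatrixIdeal 𝒜 P ∧ ProperFamily 𝒜 P}, ∀ Q ∈ c, Q ≤ P by
    obtain ⟨P, -, hP⟩ := zorn_le_nonempty₀ _ H (DetSum 𝒜) ⟨matrixIdeal_detSum, h⟩
    exact ⟨P, hP⟩
  intro c hc hchain P₀ hP₀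
  refine ⟨fun ι A => ∃ P ∈ c, P ι A, ⟨⟨?_, ?_, ?_, ?_, ?_, ?_, ?_⟩, ?_⟩,
    fun P hP ι A h => ⟨P, hP, h⟩⟩
  · rintro ι A ⟨P, hP, h⟩
    exact (hc hP).1.isHom h
  · intro ι A h
    exact ⟨P₀, hP₀, (hc hP₀).1.nonFull h⟩
  · rintro ι A B C j α β ⟨P, hP, hA⟩ ⟨Q, hQ, hB⟩ h1 h2 h3 h4
    rcases hchain.total hP hQ with hle | hle
    · exact ⟨Q, hQ, (hc hQ).1.nabla j α β (hle _ _ hA) hB h1 h2 h3 h4⟩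
    · exact ⟨P, hP, (hc hP).1.nabla j α β hA (hle _ _ hB) h1 h2 h3 h4⟩
  · rintro ι κ _ A B ⟨P, hP, h⟩ hB
    exact ⟨P, hP, (hc hP).1.sum h hB⟩
  · rintro ι κ A e f ⟨P, hP, h⟩
    exact ⟨P, hP, (hc hP).1.reindex e f h⟩
  · rintro ι A d hd ⟨P, hP, h⟩
    exact ⟨P, hP, (hc hP).1.mul_diag d hd h⟩
  · rintro ι A d hd ⟨P, hP, h⟩
    exact ⟨P, hP, (hc hP).1.diag_mul d hd h⟩
  · rintro ι _ _ a ha ha0 ⟨P, hP, h⟩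
    exact (hc hP).2 ι a ha ha0 h

theorem isHom_smul_one [SetLike.GradedMonoid 𝒜] {ι : Type} [DecidableEq ι] {a : R}
    (ha : SetLike.IsHomogeneousElem 𝒜 a) : IsHom 𝒜 (a • (1 : Matrix ι ι R)) := by
  obtain ⟨γ, ha⟩ := ha
  refine ⟨fun _ => γ, fun _ => 0, fun i j => ?_⟩
  by_cases h : i = j
  · simpa [h] using ha
  · simp [h]

variable (𝒜) in
/-- A matrix ideal containing no nonzero homogeneous scalar matrix and with the property that
a diagonal sum lies in it only if one of the summands does. -/
structure PrimeMatrixIdeal (P : ∀ ι : Type, Matrix ι ι R → Prop) : Prop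
    extends MatrixIdeal 𝒜 P where
  proper : ProperFamily 𝒜 P
  prime : ∀ {ι κ : Type} [Finite ι] [Finite κ] {A : Matrix ι ι R} {B : Matrix κ κ R},
    P (ι ⊕ κ) (Matrix.fromBlocks A 0 0 B) → P ι A ∨ P κ B

/-- The analogue of "maximal implies prime": the quotient of a maximal `P` by a homogeneous matrix
contains `P`, so it equals `P` or contains some `aI`. -/
theorem PrimeMatrixIdeal.exists_of_properFamily [SetLike.GradedMonoid 𝒜]
    (hR : IsGradedDomain 𝒜) (h : ProperFamily 𝒜 (DetSum 𝒜)) :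
    ∃ P, PrimeMatrixIdeal 𝒜 P := by
  obtain ⟨P, ⟨hP, hproper⟩, hmax⟩ := MatrixIdeal.exists_maximal h
  refine ⟨P, hP, hproper, fun {ι κ} _ _ A B hAB => ?_⟩
  have key : ∀ {μ : Type} [Finite μ] {C : Matrix μ μ R}, IsHom 𝒜 C →
      ∀ {ν : Type} {D : Matrix ν ν R}, P (ν ⊕ μ) (Matrix.fromBlocks D 0 0 C) → ¬ P ν D →
      ∃ (σ : Type) (_ : Finite σ) (_ : DecidableEq σ) (a : R), SetLike.IsHomogeneousElem 𝒜 a ∧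
        a ≠ 0 ∧ P (σ ⊕ μ) (Matrix.fromBlocks (a • (1 : Matrix σ σ R)) 0 0 C) := by
    intro μ _ C hC ν D hD hD'
    by_contra hcon
    refine hD' (hmax ⟨hP.quotient hC, fun σ _ _ a ha ha0 hσ => hcon
      ⟨σ, inferInstance, inferInstance, a, ha, ha0, hσ⟩⟩ (fun σ X hX => hP.sum hX hC) _ _ hD)
  by_contra! hcon
  have hB : IsHom 𝒜 B := by
    obtain ⟨α, β, h⟩ := hP.isHom hAB
    exact ⟨α ∘ Sum.inr, β ∘ Sum.inr, fun i j => h (Sum.inr i) (Sum.inr j)⟩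
  -- If neither summand is in `P`, then `A` is exchanged for `aI`, and after that `B` for `bI`.
  obtain ⟨σ, _, _, a, ha, ha0, h1⟩ := key hB hAB hcon.1
  have h2 : P (κ ⊕ σ) (Matrix.fromBlocks B 0 0 (a • (1 : Matrix σ σ R))) := by
    convert hP.reindex (Equiv.sumComm κ σ) (Equiv.sumComm κ σ) h1 using 1
    ext (i | i) (j | j) <;> simp
  obtain ⟨τ, _, _, b, hb, hb0, h3⟩ := key (isHom_smul_one ha) h2 hcon.2
  -- Multiplying the columns of the block `bI` by `a` on the right and the rows of the block `aI` by
  -- `b` on the left makes both blocks equal to `(ba)I`.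
  have h4 := hP.diag_mul (Sum.elim (fun _ => 1) fun _ => b)
    (Sum.forall.2 ⟨fun _ => SetLike.isHomogeneousElem_one 𝒜, fun _ => hb⟩)
    (hP.mul_diag (Sum.elim (fun _ => a) fun _ => 1)
    (Sum.forall.2 ⟨fun _ => ha, fun _ => SetLike.isHomogeneousElem_one 𝒜⟩) h3)
  refine hproper _ (b * a) (SetLike.IsHomogeneousElem.mul hb ha) ?_ (by
    convert h4 using 1
    ext (i | i) (j | j) <;> simp [Matrix.one_apply])
  intro h0
  rcases hR.eq_zero_or_eq_zero_of_mul_eq_zero _ _ hb ha h0 with h | h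
  exacts [hb0 h, ha0 h]

end Degrees

end GrMat

namespace GrMat

/-! ### Elementary operations and products modulo a prime matrix ideal -/

section PrimeIdeals

variable {Γ : Type v} [AddGroup Γ] {R : Type u} [Ring R] {𝒜 : Γ → AddSubgroup R}
  {P : ∀ ι : Type, Matrix ι ι R → Prop} {ι κ : Type}

open Matrix

theorem MatrixIdeal.neg [SetLike.GradedMonoid 𝒜] (hP : MatrixIdeal 𝒜 P) {A : Matrix ι ι R} (h : P _ A) : P _ (-A) := by
  convert hP.mul_diag (fun _ => -1)
    (fun _ => ⟨0, neg_mem (SetLike.one_mem_graded 𝒜)⟩) h using 1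
  ext i j
  simp

theorem MatrixIdeal.reindex_iff (hP : MatrixIdeal 𝒜 P) {A : Matrix ι ι R} (e f : κ ≃ ι) :
    P κ (A.submatrix e f) ↔ P ι A :=
  ⟨fun h => by simpa using hP.reindex e.symm f.symm h, hP.reindex e f⟩

/-- Columns are replaced one at a time. Each replacement is a determinantal sum with a matrix `N`
carrying the difference in column `j`, and its other columns come from a mixture of `M` and `M'`. -/
theorem MatrixIdeal.update_columns [Fintype ι] (hP : MatrixIdeal 𝒜 P) {α β : ι → Γ}
    {M M' : Matrix ι ι R} (hM : HasDeg 𝒜 α β M) (hM' : HasDeg 𝒜 α β M')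
    (h : ∀ j, (∀ i, M' i j = M i j) ∨ ∀ N, HasDeg 𝒜 α β N → (∀ i, N i j = M' i j - M i j) →
      (∀ k ≠ j, (∀ i, N i k = M i k) ∨ ∀ i, N i k = M' i k) → NonFull 𝒜 N) (h0 : P ι M) :
    P ι M' := by
  classical
  have key : ∀ s : Finset ι, P ι (of fun i j => if j ∈ s then M' i j else M i j) := by
    intro s
    induction s using Finset.induction_on with
    | empty => exact h0
    | insert j s hj ih =>
      rcases h j with h | h
      · convert ih using 1
        ext i k
        by_cases hk : k = j <;> simp [hk, h, hj]
      · have hN : HasDeg 𝒜 α β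
            (of fun i k => if k = j then M' i j - M i j else if k ∈ s then M' i k else M i k) := by
          intro i k
          rw [of_apply]
          split_ifs with h1 h2
          · subst h1
            exact sub_mem (hM' i k) (hM i k)
          · exact hM' i k
          · exact hM i k
        refine hP.nabla j α β ih (hP.nonFull (h _ hN (by simp) fun k hk => ?_)) ?_ hN ?_ ?_
        · by_cases hks : k ∈ s <;> simp [hk, hks]
        · intro i k
          rw [of_apply]
          split_ifs
          exacts [hM' i k, hM i k]
        · simp [hj]
        · intro i k hk
          simp [hk]
  convert key Finset.univ using 1
  ext i j
  simp

/-- The rows of the identity matrix with index different from `j`. -/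
def oneEraseRow (R : Type*) [Ring R] [DecidableEq ι] (j : ι) : Matrix {k // k ≠ j} ι R :=
  of fun l k => if l.1 = k then 1 else 0

theorem hasDeg_oneEraseRow [SetLike.GradedMonoid 𝒜] [DecidableEq ι] (j : ι) (β : ι → Γ) :
    HasDeg 𝒜 (fun k : {k // k ≠ j} => β k) β (oneEraseRow R j) := fun l k => by
  rw [oneEraseRow, of_apply]
  split_ifs with h
  · simpa [h] using SetLike.one_mem_graded 𝒜
  · exact zero_mem _

theorem sum_mul_oneEraseRow [Fintype ι] [DecidableEq ι] (j : ι) (v : ι → R) (k : ι) :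
    ∑ l : {k // k ≠ j}, v l * oneEraseRow R j l k = if k = j then 0 else v k := by
  split_ifs with h
  · subst h
    exact Finset.sum_eq_zero fun l _ => by simp [oneEraseRow, l.2]
  · rw [Finset.sum_eq_single ⟨k, h⟩]
    · simp [oneEraseRow]
    · rintro ⟨l, hl⟩ _ hlk
      simp only [ne_eq, Subtype.mk.injEq] at hlk
      simp [oneEraseRow, hlk]
    · simp

/-- The zero block has `|ι|` rows and `|κ| + 1` columns, so its dimensions add up to more than the
size of `N`; column `j` of the upper part can be dropped from the factorization. -/
theorem nonFull_of_zero_block [SetLike.GradedMonoid 𝒜] [Fintype ι] [Fintype κ]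
    {α β : ι → Γ} {α' β' : κ → Γ} {N : Matrix (ι ⊕ κ) (ι ⊕ κ) R}
    (hN : HasDeg 𝒜 (Sum.elim α α') (Sum.elim β β') N) (j : ι)
    (h1 : ∀ i, N (Sum.inl i) (Sum.inl j) = 0) (h2 : ∀ i k, N (Sum.inl i) (Sum.inr k) = 0) :
    NonFull 𝒜 N := by
  classical
  rw [← N.fromBlocks_toBlocks] at hN
  simp only [hasDeg_fromBlocks] at hN
  refine ⟨{k // k ≠ j} ⊕ κ, inferInstance, Sum.elim α α', Sum.elim β β',
    Sum.elim (fun k => β k) α',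
    fromBlocks (of fun i k => N (Sum.inl i) (Sum.inl k)) 0 0 1,
    fromBlocks (oneEraseRow R j) 0 N.toBlocks₂₁ N.toBlocks₂₂, ?_, ?_, ?_, ?_⟩
  · have := Fintype.card_pos_iff.2 ⟨j⟩
    simp only [Nat.card_eq_fintype_card, Fintype.card_sum, ne_eq, Fintype.card_subtype_compl,
      Fintype.card_subtype_eq]
    omega
  · simp only [hasDeg_fromBlocks, hasDeg_one, hasDeg_zero, and_true]
    exact fun i k => hN.1.1 i k
  · simpa [hN] using hasDeg_oneEraseRow j β
  · ext (i | i) (k | k)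
    · have := sum_mul_oneEraseRow j (fun k => N (Sum.inl i) (Sum.inl k)) k
      simp only [mul_apply, Fintype.sum_sum_type, fromBlocks_apply₁₁, fromBlocks_apply₁₂,
        of_apply, this, Matrix.zero_apply, zero_mul, Finset.sum_const_zero, add_zero]
      split_ifs with h
      · rw [h, h1]
      · rfl
    · simp [fromBlocks_multiply, h2]
    · simp [fromBlocks_multiply, toBlocks₂₁]
    · simp [fromBlocks_multiply, toBlocks₂₂]

theorem nonFull_of_column_mem_span [SetLike.GradedMonoid 𝒜] [Fintype ι] [Fintype κ]
    {α β : ι → Γ} {α' β' : κ → Γ} {N : Matrix (ι ⊕ κ) (ι ⊕ κ) R}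
    (hN : HasDeg 𝒜 (Sum.elim α α') (Sum.elim β β') N) (j : κ) {U : Matrix ι κ R}
    (hU : HasDeg 𝒜 β β' U)
    (h : ∀ i, N i (Sum.inr j) = ∑ k, N i (Sum.inl k) * U k j) :
    NonFull 𝒜 N := by
  classical
  refine ⟨ι ⊕ {k // k ≠ j}, inferInstance, Sum.elim α α', Sum.elim β β',
    Sum.elim β (fun k => β' k),
    fromCols (of fun i k => N i (Sum.inl k)) (of fun i k => N i (Sum.inr k)),
    fromBlocks 1 (of fun l k => if k = j then U l k else 0) 0 (oneEraseRow R j), ?_, ?_, ?_, ?_⟩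
  · have := Fintype.card_pos_iff.2 ⟨j⟩
    simp only [Nat.card_eq_fintype_card, Fintype.card_sum, ne_eq, Fintype.card_subtype_compl,
      Fintype.card_subtype_eq]
    omega
  · rw [hasDeg_fromCols]
    exact ⟨fun i k => hN i (Sum.inl k), fun i k => hN i (Sum.inr k)⟩
  · simp only [hasDeg_fromBlocks, hasDeg_one, hasDeg_zero, true_and]
    refine ⟨fun l k => ?_, hasDeg_oneEraseRow j β'⟩
    rw [of_apply]
    split_ifs
    exacts [hU l k, zero_mem _]
  · ext i (k | k)
    · simp [mul_apply, one_apply]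
    · have := sum_mul_oneEraseRow j (fun k => N i (Sum.inr k)) k
      rw [mul_apply, Fintype.sum_sum_type]
      simp only [fromCols_apply_inl, fromCols_apply_inr, fromBlocks_apply₁₂, fromBlocks_apply₂₂,
        of_apply, this]
      split_ifs with hk
      · subst hk
        simp [h]
      · simp

variable [SetLike.GradedMonoid 𝒜] [Fintype ι] [Fintype κ] {α β : ι → Γ} {α' β' : κ → Γ}

/-- A difference column vanishes in the upper rows, and together with the upper right block it forms
a zero block that is too large for fullness. -/
theorem MatrixIdeal.change_lower_left (hP : MatrixIdeal 𝒜 P) {A : Matrix ι ι R}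
    {C C' : Matrix κ ι R} {D : Matrix κ κ R} (hA : HasDeg 𝒜 α β A) (hC : HasDeg 𝒜 α' β C)
    (hC' : HasDeg 𝒜 α' β C') (hD : HasDeg 𝒜 α' β' D) (h : P _ (fromBlocks A 0 C D)) :
    P _ (fromBlocks A 0 C' D) := by
  refine hP.update_columns (α := Sum.elim α α') (β := Sum.elim β β') (M' := fromBlocks A 0 C' D)
    (by simp [hA, hC, hD]) (by simp [hA, hC', hD]) (fun j => ?_) h
  rcases j with j | j
  · right
    intro N hN h1 h2
    refine nonFull_of_zero_block hN j (fun i => by simp [h1]) fun i k => ?_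
    rcases h2 (Sum.inr k) (by simp) with h | h <;> simp [h]
  · left
    rintro (i | i) <;> simp

/-- A difference column is a right combination of the columns in the left block, so the correcting
matrix is never full. -/
theorem MatrixIdeal.add_mul_right (hP : MatrixIdeal 𝒜 P) {A : Matrix ι ι R} {B : Matrix ι κ R}
    {C : Matrix κ ι R} {D : Matrix κ κ R} {U : Matrix ι κ R} (hA : HasDeg 𝒜 α β A)
    (hB : HasDeg 𝒜 α β' B) (hC : HasDeg 𝒜 α' β C) (hD : HasDeg 𝒜 α' β' D)
    (hU : HasDeg 𝒜 β β' U) (h : P _ (fromBlocks A B C D)) :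
    P _ (fromBlocks A (B + A * U) C (D + C * U)) := by
  refine hP.update_columns (α := Sum.elim α α') (β := Sum.elim β β')
    (M' := fromBlocks A (B + A * U) C (D + C * U))
    (by simp [hA, hB, hC, hD]) (by simp [hA, hB.add (hA.mul hU), hC, hD.add (hC.mul hU)])
    (fun j => ?_) h
  rcases j with j | j
  · left
    rintro (i | i) <;> simp
  · right
    intro N hN h1 h2
    refine nonFull_of_column_mem_span hN j hU fun i => ?_
    have h3 : ∀ k, N i (Sum.inl k) = fromBlocks A B C D i (Sum.inl k) := by
      intro k
      rcases h2 (Sum.inl k) (by simp) with h | h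
      · exact h i
      · rw [h i]
        rcases i with i | i <;> simp
    simp only [h3, h1]
    rcases i with i | i <;> simp [mul_apply]

theorem PrimeMatrixIdeal.not_one [Nontrivial R] [DecidableEq ι] (hP : PrimeMatrixIdeal 𝒜 P) :
    ¬ P ι 1 := by
  simpa using hP.proper ι 1 (SetLike.isHomogeneousElem_one 𝒜) one_ne_zero

theorem PrimeMatrixIdeal.lower_triangular_iff (hP : PrimeMatrixIdeal 𝒜 P) {A : Matrix ι ι R}
    {C : Matrix κ ι R} {D : Matrix κ κ R} (hA : HasDeg 𝒜 α β A) (hC : HasDeg 𝒜 α' β C)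
    (hD : HasDeg 𝒜 α' β' D) : P _ (fromBlocks A 0 C D) ↔ P _ A ∨ P _ D := by
  constructor
  · exact fun h => hP.prime (hP.change_lower_left hA hC hasDeg_zero hD h)
  · rintro (h | h)
    · exact hP.change_lower_left hA hasDeg_zero hC hD (hP.sum h ⟨_, _, hD⟩)
    · refine hP.change_lower_left hA hasDeg_zero hC hD ?_
      convert hP.reindex (Equiv.sumComm ι κ) (Equiv.sumComm ι κ) (hP.sum h ⟨_, _, hA⟩) using 1
      ext (i | i) (j | j) <;> simp

theorem PrimeMatrixIdeal.upper_triangular_iff (hP : PrimeMatrixIdeal 𝒜 P) {A : Matrix ι ι R}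
    {B : Matrix ι κ R} {D : Matrix κ κ R} (hA : HasDeg 𝒜 α β A) (hB : HasDeg 𝒜 α β' B)
    (hD : HasDeg 𝒜 α' β' D) : P _ (fromBlocks A B 0 D) ↔ P _ A ∨ P _ D := by
  rw [or_comm, ← hP.lower_triangular_iff hD hB hA]
  constructor
  · intro h
    convert hP.reindex (Equiv.sumComm κ ι) (Equiv.sumComm κ ι) h using 1
    ext (i | i) (j | j) <;> simp
  · intro h
    convert hP.reindex (Equiv.sumComm ι κ) (Equiv.sumComm ι κ) h using 1
    ext (i | i) (j | j) <;> simp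

variable {γ : ι → Γ}

/-- Column operations and a swap of the column blocks lead from `(A 0; 1 E)` to `(-AE A; 0 1)`.
Primeness then isolates `-AE`, because the identity is not in `P`. -/
theorem PrimeMatrixIdeal.mul_right [Nontrivial R] (hP : PrimeMatrixIdeal 𝒜 P)
    {A E : Matrix ι ι R} (hA : HasDeg 𝒜 α β A) (hE : HasDeg 𝒜 β γ E) (h : P _ A) :
    P _ (A * E) := by
  classical
  have h1 : P _ (fromBlocks A 0 1 E) :=
    (hP.lower_triangular_iff hA (hasDeg_one (α := β)) hE).2 (Or.inl h)
  have h2 := hP.add_mul_right (U := -E) hA hasDeg_zero (hasDeg_one (α := β)) hE hE.neg h1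
  have h3 := hP.reindex (Equiv.refl _) (Equiv.sumComm ι ι) h2
  have h4 : P _ (fromBlocks (-(A * E)) A 0 1) := by
    convert h3 using 1
    ext (i | i) (j | j) <;> simp
  rcases (hP.upper_triangular_iff (hA.mul hE).neg hA (hasDeg_one (α := β))).1 h4 with h5 | h5
  · simpa using hP.neg h5
  · exact absurd h5 hP.not_one

theorem PrimeMatrixIdeal.mul_left [Nontrivial R] (hP : PrimeMatrixIdeal 𝒜 P)
    {A E : Matrix ι ι R} (hE : HasDeg 𝒜 γ α E) (hA : HasDeg 𝒜 α β A) (h : P _ A) :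
    P _ (E * A) := by
  classical
  have h1 : P _ (fromBlocks A 1 0 E) :=
    (hP.upper_triangular_iff hA (hasDeg_one (α := α)) hE).2 (Or.inl h)
  have h2 : P _ (fromBlocks 1 A E 0) := by
    convert hP.reindex (Equiv.refl _) (Equiv.sumComm ι ι) h1 using 1
    ext (i | i) (j | j) <;> simp
  have h3 := hP.add_mul_right (U := -A) (hasDeg_one (α := α)) hA hE hasDeg_zero hA.neg h2
  have h4 : P _ (fromBlocks 1 0 E (-(E * A))) := by
    convert h3 using 1
    simp
  rcases (hP.lower_triangular_iff (hasDeg_one (α := α)) hE (hE.mul hA).neg).1 h4 with h5 | h5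
  · exact absurd h5 hP.not_one
  · simpa using hP.neg h5

end PrimeIdeals

end GrMat

namespace GrMat

open Matrix

/-! ### Block matrices and the calculus of formal fractions -/

section Blocks

variable {R m m₁ m₂ n n₁ n₂ : Type*} [Ring R]

theorem fromRows_add_fromRows (A B : Matrix m₁ n R) (C D : Matrix m₂ n R) :
    fromRows A C + fromRows B D = fromRows (A + B) (C + D) := by
  ext (i | i) j <;> simp

theorem fromCols_add_fromCols (A B : Matrix m n₁ R) (C D : Matrix m n₂ R) :
    fromCols A C + fromCols B D = fromCols (A + B) (C + D) := by
  ext i (j | j) <;> simp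

end Blocks

/-- A formal expression `f A⁻¹ x` with `A` a square matrix, `x` a column and `f` a row. -/
structure Frac (R : Type u) where
  /-- the index type -/
  ι : Type
  [fintype : Fintype ι]
  [decEq : DecidableEq ι]
  /-- the denominator -/
  A : Matrix ι ι R
  /-- the column -/
  x : Matrix ι Unit R
  /-- the row -/
  f : Matrix Unit ι R

namespace Frac

attribute [instance] Frac.fintype Frac.decEq

variable {Γ : Type v} [AddGroup Γ] {R : Type u} [Ring R]

/-- The expression represents zero: the bordered matrix lies in `P`. -/
def IsZero (P : ∀ ι : Type, Matrix ι ι R → Prop) (p : Frac R) : Prop :=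
  P _ (fromBlocks p.A p.x p.f 0)

/-- The sum of two expressions. -/
abbrev add (p q : Frac R) : Frac R :=
  ⟨p.ι ⊕ q.ι, fromBlocks p.A 0 0 q.A, fromRows p.x q.x, fromCols p.f q.f⟩

/-- The negative of an expression. -/
abbrev neg (p : Frac R) : Frac R := ⟨p.ι, p.A, p.x, -p.f⟩

/-- The product of two expressions. -/
abbrev mul (p q : Frac R) : Frac R :=
  ⟨p.ι ⊕ q.ι, fromBlocks p.A (-(p.x * q.f)) 0 q.A, fromRows 0 q.x, fromCols p.f 0⟩

variable (R) in
/-- The empty expression. -/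
abbrev zero : Frac R := ⟨Empty, 0, 0, 0⟩

/-- The expression `r · 1⁻¹ · 1`. -/
abbrev ofRing (r : R) : Frac R := ⟨Unit, 1, 1, of fun _ _ => r⟩

/-- The inverse of an expression. -/
abbrev inv (p : Frac R) : Frac R :=
  ⟨p.ι ⊕ Unit, fromBlocks p.A p.x p.f 0, fromRows 0 (-1), fromCols 0 1⟩

/-- Two expressions are identified if their difference represents zero. -/
def Rel (P : ∀ ι : Type, Matrix ι ι R → Prop) (p q : Frac R) : Prop := IsZero P (p.add q.neg)

/-- The entries of `p` are homogeneous, with degrees making `p` an expression of degree `ε - δ`,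
and its denominator is not in `P`. -/
structure HasDegrees (𝒜 : Γ → AddSubgroup R) (P : ∀ ι : Type, Matrix ι ι R → Prop)
    (p : Frac R) (α β : p.ι → Γ) (ε δ : Γ) : Prop where
  A : HasDeg 𝒜 α β p.A
  x : HasDeg 𝒜 α (fun _ => δ) p.x
  f : HasDeg 𝒜 (fun _ => ε) β p.f
  not_mem : ¬ P _ p.A

variable {𝒜 : Γ → AddSubgroup R}
  {P : ∀ ι : Type, Matrix ι ι R → Prop} {p q r p' q' : Frac R}
  {α β : p.ι → Γ} {α' β' : q.ι → Γ} {α'' β'' : r.ι → Γ} {ε δ η ζ : Γ}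

theorem HasDegrees.add (hP : PrimeMatrixIdeal 𝒜 P) (hp : p.HasDegrees 𝒜 P α β ε δ)
    (hq : q.HasDegrees 𝒜 P α' β' ε δ) :
    (p.add q).HasDegrees 𝒜 P (Sum.elim α α') (Sum.elim β β') ε δ where
  A := by simp [hp.A, hq.A]
  x := by simp [hp.x, hq.x]
  f := by simp [hp.f, hq.f]
  not_mem h := (hP.prime h).elim hp.not_mem hq.not_mem

theorem HasDegrees.neg (hp : p.HasDegrees 𝒜 P α β ε δ) : p.neg.HasDegrees 𝒜 P α β ε δ where
  A := hp.A
  x := hp.x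
  f := hp.f.neg
  not_mem := hp.not_mem

theorem HasDegrees.add_right (hp : p.HasDegrees 𝒜 P α β ε δ) (τ : Γ) :
    p.HasDegrees 𝒜 P (fun i => α i + τ) (fun i => β i + τ) (ε + τ) (δ + τ) where
  A := hp.A.add_right τ
  x := hp.x.add_right τ
  f := hp.f.add_right τ
  not_mem := hp.not_mem

theorem HasDegrees.bordered (hp : p.HasDegrees 𝒜 P α β ε δ) :
    HasDeg 𝒜 (Sum.elim α fun _ => ε) (Sum.elim β fun _ => δ) (fromBlocks p.A p.x p.f 0) := by
  simp [hp.A, hp.x, hp.f]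

theorem isZero_add_comm (hP : PrimeMatrixIdeal 𝒜 P) :
    (p.add q).IsZero P ↔ (q.add p).IsZero P := by
  let e := (Equiv.sumComm q.ι p.ι).sumCongr (Equiv.refl Unit)
  rw [IsZero, ← hP.reindex_iff e e]
  refine iff_of_eq (congrArg _ ?_)
  ext ((i | i) | i) ((j | j) | j) <;> simp [e]

variable [SetLike.GradedMonoid 𝒜]

theorem HasDegrees.mul (hP : PrimeMatrixIdeal 𝒜 P) (hp : p.HasDegrees 𝒜 P α β ε δ)
    (hq : q.HasDegrees 𝒜 P α' β' δ η) :
    (p.mul q).HasDegrees 𝒜 P (Sum.elim α α') (Sum.elim β β') ε η where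
  A := by simp [hp.A, hq.A, hp.x.mul hq.f]
  x := by simp [hq.x]
  f := by simp [hp.f]
  not_mem h := ((hP.upper_triangular_iff hp.A (hp.x.mul hq.f).neg hq.A).1 h).elim
    hp.not_mem hq.not_mem

theorem hasDegrees_zero [Nontrivial R] (hP : PrimeMatrixIdeal 𝒜 P) (ε δ : Γ) :
    (zero R).HasDegrees 𝒜 P (fun i => i.elim) (fun i => i.elim) ε δ where
  A := hasDeg_zero
  x := hasDeg_zero
  f := hasDeg_zero
  not_mem h := hP.not_one (ι := Empty) (by convert h using 1; ext i; exact i.elim)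

theorem hasDegrees_ofRing [Nontrivial R] (hP : PrimeMatrixIdeal 𝒜 P) {s : R} (δ : Γ)
    (h : s ∈ 𝒜 (ε - δ)) : (ofRing s).HasDegrees 𝒜 P (fun _ => δ) (fun _ => δ) ε δ where
  A := hasDeg_one
  x := hasDeg_one
  f := fun _ _ => h
  not_mem := hP.not_one

theorem HasDegrees.inv (hp : p.HasDegrees 𝒜 P α β ε δ) (h : ¬ p.IsZero P) :
    p.inv.HasDegrees 𝒜 P (Sum.elim α fun _ => ε) (Sum.elim β fun _ => δ) δ ε where
  A := by simp [hp.A, hp.x, hp.f]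
  x := by simp
  f := by simp
  not_mem := h

/-- Two expressions connected by a morphism of linear systems are equal. -/
theorem rel_of_intertwine (hP : PrimeMatrixIdeal 𝒜 P) (hp : p.HasDegrees 𝒜 P α β ε δ)
    (hq : q.HasDegrees 𝒜 P α' β' ε δ) (S T : Matrix q.ι p.ι R) (hS : HasDeg 𝒜 α' α S)
    (hT : HasDeg 𝒜 β' β T) (hA : S * p.A = q.A * T) (hx : S * p.x = q.x) (hf : q.f * T = p.f) :
    Rel P p q := by
  -- Formally `f A⁻¹ x = g T A⁻¹ x = g B⁻¹ S x = g B⁻¹ y`. Correspondingly, the bordered matrix of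
  -- the difference, of size `|p.ι| + |q.ι| + 1`, factors through size `|p.ι| + |q.ι|`.
  refine hP.nonFull ⟨p.ι ⊕ q.ι, inferInstance, Sum.elim (Sum.elim α α') fun _ => ε,
    Sum.elim (Sum.elim β β') fun _ => δ, Sum.elim α β',
    fromRows (fromBlocks 1 0 S q.A) (fromCols 0 (-q.f)),
    fromCols (fromBlocks p.A 0 (-T) 1) (fromRows p.x 0), by simp, ?_, ?_, ?_⟩
  · simp [hS, hq.A, hq.f]
  · simp [hp.A, hT, hp.x]
  · simp [fromBlocks_multiply, fromBlocks_mul_fromRows,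
      fromCols_mul_fromBlocks, fromCols_mul_fromRows, hA, hx, hf]

theorem isZero_neg_iff (hP : PrimeMatrixIdeal 𝒜 P) : p.neg.IsZero P ↔ p.IsZero P := by
  have key : ∀ q : Frac R, q.IsZero P → q.neg.IsZero P := fun q h => by
    unfold IsZero
    convert hP.diag_mul (Sum.elim (fun _ => 1) fun _ => -1)
      (Sum.forall.2 ⟨fun _ => ⟨0, SetLike.one_mem_graded 𝒜⟩,
        fun _ => ⟨0, neg_mem (SetLike.one_mem_graded 𝒜)⟩⟩) h using 1
    ext (i | i) (j | j) <;> simp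
  exact ⟨fun h => by simpa [Frac.neg] using key _ h, key p⟩

/-- The last column of the bordered matrix of `p + q` splits as `(p.x, 0) + (0, q.x)`. Both
resulting matrices are block triangular up to permutation: the first is controlled by `p` being
zero, and the second lies in `P` because `q` is zero. -/
theorem isZero_add_iff (hP : PrimeMatrixIdeal 𝒜 P) (hp : p.HasDegrees 𝒜 P α β ε δ)
    (hq : q.HasDegrees 𝒜 P α' β' ε δ) (h : q.IsZero P) :
    (p.add q).IsZero P ↔ p.IsZero P := by
  have h1 : P _ (fromBlocks (fromBlocks p.A 0 0 q.A) (fromRows p.x 0) (fromCols p.f q.f) 0) ↔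
      p.IsZero P := by
    have h2 : P _ (fromBlocks (fromBlocks p.A p.x p.f 0) (fromRows 0 q.f) 0 q.A) ↔ p.IsZero P := by
      rw [hP.upper_triangular_iff hp.bordered (β' := β') (by simp [hq.f]) hq.A]
      exact or_iff_left hq.not_mem
    rw [← h2]
    let e : (p.ι ⊕ Unit) ⊕ q.ι ≃ (p.ι ⊕ q.ι) ⊕ Unit := (Equiv.sumAssoc p.ι Unit q.ι).trans
      (((Equiv.refl p.ι).sumCongr (Equiv.sumComm Unit q.ι)).trans
        (Equiv.sumAssoc p.ι q.ι Unit).symm)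
    rw [← hP.reindex_iff e e]
    refine iff_of_eq (congrArg _ ?_)
    ext ((i | i) | i) ((j | j) | j) <;> simp [e]
  have h3 : ∀ y : Matrix q.ι Unit R, HasDeg 𝒜 α' (fun _ => δ) y →
      P _ (fromBlocks q.A y q.f 0) →
      P _ (fromBlocks (fromBlocks p.A 0 0 q.A) (fromRows 0 y) (fromCols p.f q.f) 0) := by
    intro y hy h
    have h4 := (hP.lower_triangular_iff (α := α) (β := β) (A := p.A) (C := fromRows 0 p.f)
      (α' := Sum.elim α' fun _ => ε) (β' := Sum.elim β' fun _ => δ) hp.A (by simp [hp.f])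
      (by simp [hq.A, hq.f, hy])).2 (Or.inr h)
    rw [← hP.reindex_iff (Equiv.sumAssoc p.ι q.ι Unit).symm (Equiv.sumAssoc p.ι q.ι Unit).symm]
    convert h4 using 1
    ext (i | i | i) (j | j | j) <;> simp
  -- The sign change allows the `q` part of the last column to be subtracted again.
  have h5 : P _ (fromBlocks q.A (-q.x) q.f 0) := by
    convert hP.mul_diag (Sum.elim (fun _ => 1) fun _ => -1)
      (Sum.forall.2 ⟨fun _ => ⟨0, SetLike.one_mem_graded 𝒜⟩,
        fun _ => ⟨0, neg_mem (SetLike.one_mem_graded 𝒜)⟩⟩) h using 1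
    ext (i | i) (j | j) <;> simp
  rw [← h1]
  constructor
  · intro h6
    refine hP.nabla (Sum.inr ()) (Sum.elim (Sum.elim α α') fun _ => ε)
      (Sum.elim (Sum.elim β β') fun _ => δ) h6 (h3 _ hq.x.neg h5) ?_ ?_ ?_ ?_
    · simp [hp.A, hp.x, hp.f, hq.A, hq.x, hq.f]
    · simp [hp.A, hp.f, hq.A, hq.x, hq.f]
    · rintro ((i | i) | i) <;> simp
    · rintro ((i | i) | i) ((j | j) | j) <;> simp
  · intro h6
    refine hP.nabla (Sum.inr ()) (Sum.elim (Sum.elim α α') fun _ => ε)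
      (Sum.elim (Sum.elim β β') fun _ => δ) h6 (h3 _ hq.x h) ?_ ?_ ?_ ?_
    · simp [hp.A, hp.x, hp.f, hq.A, hq.f]
    · simp [hp.A, hp.f, hq.A, hq.x, hq.f]
    · rintro ((i | i) | i) <;> simp
    · rintro ((i | i) | i) ((j | j) | j) <;> simp

theorem Rel.isZero_iff (hP : PrimeMatrixIdeal 𝒜 P) (hp : p.HasDegrees 𝒜 P α β ε δ)
    (hq : q.HasDegrees 𝒜 P α' β' ε δ) (h : Rel P p q) : p.IsZero P ↔ q.IsZero P := by
  constructor
  · intro h1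
    rw [← isZero_neg_iff hP, ← isZero_add_iff hP hq.neg hp h1]
    exact (isZero_add_comm hP).1 h
  · intro h1
    exact (isZero_add_iff hP hp hq.neg ((isZero_neg_iff hP).2 h1)).1 h

theorem rel_refl (hP : PrimeMatrixIdeal 𝒜 P) (hp : p.HasDegrees 𝒜 P α β ε δ) : Rel P p p :=
  rel_of_intertwine hP hp hp 1 1 hasDeg_one hasDeg_one (by simp) (by simp) (by simp)

theorem Rel.symm (hP : PrimeMatrixIdeal 𝒜 P) (h : Rel P p q) : Rel P q p := by
  rw [Rel, isZero_add_comm hP, ← isZero_neg_iff hP] at h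
  simpa [Rel, Frac.neg] using h

/-- `(p - q) + (q - r)` is a rearrangement of `(p - r) + (q - q)`, and adding a zero expression does
not affect being zero. -/
theorem Rel.trans (hP : PrimeMatrixIdeal 𝒜 P) (hp : p.HasDegrees 𝒜 P α β ε δ)
    (hq : q.HasDegrees 𝒜 P α' β' ε δ) (hr : r.HasDegrees 𝒜 P α'' β'' ε δ)
    (h : Rel P p q) (h' : Rel P q r) : Rel P p r := by
  have h1 := (isZero_add_iff hP (hp.add hP hq.neg) (hq.add hP hr.neg) h').2 h
  have h2 : Rel P ((p.add q.neg).add (q.add r.neg)) ((p.add r.neg).add (q.add q.neg)) := by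
    refine rel_of_intertwine hP ((hp.add hP hq.neg).add hP (hq.add hP hr.neg))
      ((hp.add hP hr.neg).add hP (hq.add hP hq.neg))
      (fromBlocks (fromBlocks 1 0 0 0) (fromBlocks 0 0 0 1) (fromBlocks 0 0 0 1)
        (fromBlocks 1 0 0 0))
      (fromBlocks (fromBlocks 1 0 0 0) (fromBlocks 0 0 0 1) (fromBlocks 0 0 0 1)
        (fromBlocks 1 0 0 0)) ?_ ?_ ?_ ?_ ?_
    · simp
    · simp
    · simp [fromBlocks_multiply]
    · simp [fromBlocks_mul_fromRows, fromRows_add_fromRows]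
    · simp [fromCols_mul_fromBlocks, fromCols_add_fromCols]
  rw [h2.isZero_iff hP ((hp.add hP hq.neg).add hP (hq.add hP hr.neg))
      ((hp.add hP hr.neg).add hP (hq.add hP hq.neg)),
    isZero_add_iff hP (hp.add hP hr.neg) (hq.add hP hq.neg) (rel_refl hP hq)] at h1
  exact h1

theorem Rel.add (hP : PrimeMatrixIdeal 𝒜 P) {γ γ' : p'.ι → Γ} {κ κ' : q'.ι → Γ}
    (hp : p.HasDegrees 𝒜 P α β ε δ) (hq : q.HasDegrees 𝒜 P α' β' ε δ)
    (hp' : p'.HasDegrees 𝒜 P γ γ' ε δ) (hq' : q'.HasDegrees 𝒜 P κ κ' ε δ)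
    (h : Rel P p p') (h' : Rel P q q') : Rel P (p.add q) (p'.add q') := by
  have h1 := (isZero_add_iff hP (hp.add hP hp'.neg) (hq.add hP hq'.neg) h').2 h
  refine (Rel.isZero_iff hP ((hp.add hP hp'.neg).add hP (hq.add hP hq'.neg))
    ((hp.add hP hq).add hP (hp'.add hP hq').neg) ?_).1 h1
  refine rel_of_intertwine hP ((hp.add hP hp'.neg).add hP (hq.add hP hq'.neg))
    ((hp.add hP hq).add hP (hp'.add hP hq').neg)
    (fromBlocks (fromBlocks 1 0 0 0) (fromBlocks 0 0 1 0) (fromBlocks 0 1 0 0)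
      (fromBlocks 0 0 0 1))
    (fromBlocks (fromBlocks 1 0 0 0) (fromBlocks 0 0 1 0) (fromBlocks 0 1 0 0)
      (fromBlocks 0 0 0 1)) ?_ ?_ ?_ ?_ ?_
  · simp
  · simp
  · simp [fromBlocks_multiply]
  · simp [fromBlocks_mul_fromRows, fromRows_add_fromRows]
  · simp [fromCols_mul_fromBlocks, fromCols_add_fromCols]

theorem Rel.neg (hP : PrimeMatrixIdeal 𝒜 P) (h : Rel P p q) : Rel P p.neg q.neg := by
  rw [Rel, ← isZero_neg_iff hP] at h
  simpa [Rel, Frac.neg] using h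

/-- Up to a permutation, the bordered matrix of the product is the diagonal sum of the bordered
matrix of `p` and an identity, times a homogeneous matrix. -/
theorem IsZero.mul_right [Nontrivial R] (hP : PrimeMatrixIdeal 𝒜 P)
    (hp : p.HasDegrees 𝒜 P α β ε δ) (hq : q.HasDegrees 𝒜 P α' β' δ η) (h : p.IsZero P) :
    (p.mul q).IsZero P := by
  have h1 : P _ (fromBlocks (fromBlocks p.A p.x p.f 0) 0 0 (1 : Matrix q.ι q.ι R)) :=
    hP.sum h ⟨α', α', hasDeg_one⟩
  have h2 := hP.mul_right (α := Sum.elim (Sum.elim α fun _ => ε) α')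
    (β := Sum.elim (Sum.elim β fun _ => δ) α') (γ := Sum.elim (Sum.elim β fun _ => η) β')
    (E := fromBlocks (fromBlocks 1 0 0 0) (fromRows 0 (-q.f)) (fromCols 0 q.x) q.A)
    (by simp [hp.A, hp.x, hp.f]) (by simp [hq.A, hq.x, hq.f]) h1
  let e : (p.ι ⊕ Unit) ⊕ q.ι ≃ (p.ι ⊕ q.ι) ⊕ Unit := (Equiv.sumAssoc p.ι Unit q.ι).trans
      (((Equiv.refl p.ι).sumCongr (Equiv.sumComm Unit q.ι)).trans
        (Equiv.sumAssoc p.ι q.ι Unit).symm)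
  rw [IsZero, ← hP.reindex_iff e e]
  convert h2 using 1
  simp only [fromBlocks_multiply, fromBlocks_mul_fromRows]
  ext ((i | i) | i) ((j | j) | j) <;> simp [e]

theorem IsZero.mul_left [Nontrivial R] (hP : PrimeMatrixIdeal 𝒜 P)
    (hp : p.HasDegrees 𝒜 P α β ε δ) (hq : q.HasDegrees 𝒜 P α' β' δ η) (h : q.IsZero P) :
    (p.mul q).IsZero P := by
  have h1 : P _ (fromBlocks (1 : Matrix p.ι p.ι R) 0 0 (fromBlocks q.A q.x q.f 0)) :=
    (hP.lower_triangular_iff (α := β) (β := β) hasDeg_one hasDeg_zero hq.bordered).2 (Or.inr h)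
  have h2 := hP.mul_left (γ := Sum.elim α (Sum.elim α' fun _ => ε))
    (α := Sum.elim β (Sum.elim α' fun _ => δ)) (β := Sum.elim β (Sum.elim β' fun _ => η))
    (E := fromBlocks p.A (fromCols 0 (-p.x)) (fromRows 0 p.f) (fromBlocks 1 0 0 0))
    (by simp [hp.A, hp.x, hp.f]) (by simp [hq.A, hq.x, hq.f]) h1
  rw [IsZero, ← hP.reindex_iff (Equiv.sumAssoc p.ι q.ι Unit).symm
    (Equiv.sumAssoc p.ι q.ι Unit).symm]
  convert h2 using 1
  simp only [fromBlocks_multiply, fromCols_mul_fromBlocks]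
  ext (i | i | i) (j | j | j) <;> simp

theorem Rel.mul_right [Nontrivial R] (hP : PrimeMatrixIdeal 𝒜 P)
    (hp : p.HasDegrees 𝒜 P α β ε δ) (hq : q.HasDegrees 𝒜 P α' β' ε δ)
    (hr : r.HasDegrees 𝒜 P α'' β'' δ η) (h : Rel P p q) : Rel P (p.mul r) (q.mul r) := by
  have h1 := IsZero.mul_right hP (hp.add hP hq.neg) hr h
  refine (Rel.isZero_iff hP ((hp.add hP hq.neg).mul hP hr)
    ((hp.mul hP hr).add hP (hq.mul hP hr).neg) ?_).1 h1
  refine rel_of_intertwine hP ((hp.add hP hq.neg).mul hP hr)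
    ((hp.mul hP hr).add hP (hq.mul hP hr).neg)
    (fromBlocks (fromBlocks 1 0 0 0) (fromRows 0 1) (fromBlocks 0 1 0 0) (fromRows 0 1))
    (fromBlocks (fromBlocks 1 0 0 0) (fromRows 0 1) (fromBlocks 0 1 0 0) (fromRows 0 1))
    ?_ ?_ ?_ ?_ ?_
  · simp
  · simp
  · simp [fromBlocks_multiply, fromBlocks_mul_fromRows, fromRows_add_fromRows, fromRows_mul]
  · simp [fromBlocks_mul_fromRows, fromRows_mul]
  · simp [fromCols_mul_fromBlocks, fromCols_add_fromCols, fromCols_mul_fromRows]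

theorem Rel.mul_left [Nontrivial R] (hP : PrimeMatrixIdeal 𝒜 P)
    (hp : p.HasDegrees 𝒜 P α β ε δ) (hq : q.HasDegrees 𝒜 P α' β' δ η)
    (hr : r.HasDegrees 𝒜 P α'' β'' δ η) (h : Rel P q r) : Rel P (p.mul q) (p.mul r) := by
  have h1 := IsZero.mul_left hP hp (hq.add hP hr.neg) h
  refine (Rel.isZero_iff hP ((hp.mul hP hq).add hP (hp.mul hP hr).neg)
    (hp.mul hP (hq.add hP hr.neg)) ?_).2 h1
  -- The two copies of `p.ι` are merged. The sign `-1` is needed because the negative of a product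
  -- carries its sign in the row `p.f`.
  refine rel_of_intertwine hP ((hp.mul hP hq).add hP (hp.mul hP hr).neg)
    (hp.mul hP (hq.add hP hr.neg))
    (fromBlocks (fromCols 1 0) (fromCols (-1) 0) (fromBlocks 0 1 0 0) (fromBlocks 0 0 0 1))
    (fromBlocks (fromCols 1 0) (fromCols (-1) 0) (fromBlocks 0 1 0 0) (fromBlocks 0 0 0 1))
    ?_ ?_ ?_ ?_ ?_
  · simp
  · simp
  · simp [fromBlocks_multiply, fromCols_mul_fromBlocks, fromCols_add_fromCols,
      mul_fromCols]
  · simp [fromBlocks_mul_fromRows, fromRows_add_fromRows, fromCols_mul_fromRows]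
  · simp [fromCols_mul_fromBlocks, mul_fromCols]

theorem add_assoc_rel (hP : PrimeMatrixIdeal 𝒜 P) (hp : p.HasDegrees 𝒜 P α β ε δ)
    (hq : q.HasDegrees 𝒜 P α' β' ε δ) (hr : r.HasDegrees 𝒜 P α'' β'' ε δ) :
    Rel P ((p.add q).add r) (p.add (q.add r)) := by
  refine rel_of_intertwine hP ((hp.add hP hq).add hP hr) (hp.add hP (hq.add hP hr))
    (fromBlocks (fromCols 1 0) 0 (fromBlocks 0 1 0 0) (fromRows 0 1))
    (fromBlocks (fromCols 1 0) 0 (fromBlocks 0 1 0 0) (fromRows 0 1)) ?_ ?_ ?_ ?_ ?_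
  · simp
  · simp
  · simp [fromBlocks_multiply, fromCols_mul_fromBlocks, fromBlocks_mul_fromRows, mul_fromCols,
      fromRows_mul]
  · simp [fromBlocks_mul_fromRows, fromRows_add_fromRows, fromCols_mul_fromRows, fromRows_mul]
  · simp [fromCols_mul_fromBlocks, fromCols_add_fromCols, fromCols_mul_fromRows, mul_fromCols]

theorem add_comm_rel (hP : PrimeMatrixIdeal 𝒜 P) (hp : p.HasDegrees 𝒜 P α β ε δ)
    (hq : q.HasDegrees 𝒜 P α' β' ε δ) : Rel P (p.add q) (q.add p) := by
  refine rel_of_intertwine hP (hp.add hP hq) (hq.add hP hp)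
    (fromBlocks 0 1 1 0) (fromBlocks 0 1 1 0) ?_ ?_ ?_ ?_ ?_
  · simp
  · simp
  · simp [fromBlocks_multiply]
  · simp [fromBlocks_mul_fromRows]
  · simp [fromCols_mul_fromBlocks]

theorem zero_add_rel [Nontrivial R] (hP : PrimeMatrixIdeal 𝒜 P)
    (hp : p.HasDegrees 𝒜 P α β ε δ) : Rel P ((zero R).add p) p := by
  refine rel_of_intertwine hP ((hasDegrees_zero hP ε δ).add hP hp) hp
    (fromCols 0 1) (fromCols 0 1) ?_ ?_ ?_ ?_ ?_
  · simp
  · simp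
  · simp [fromCols_mul_fromBlocks, mul_fromCols]
  · simp [fromCols_mul_fromRows]
  · simp [mul_fromCols]

theorem rel_zero_iff [Nontrivial R] (hP : PrimeMatrixIdeal 𝒜 P)
    (hp : p.HasDegrees 𝒜 P α β ε δ) : Rel P p (zero R) ↔ p.IsZero P := by
  rw [Rel, isZero_add_comm hP]
  have : (zero R).neg = zero R := by simp [Frac.neg]
  rw [this]
  exact (zero_add_rel hP hp).isZero_iff hP ((hasDegrees_zero hP ε δ).add hP hp) hp

theorem neg_add_rel [Nontrivial R] (hP : PrimeMatrixIdeal 𝒜 P)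
    (hp : p.HasDegrees 𝒜 P α β ε δ) : Rel P (p.neg.add p) (zero R) := by
  rw [rel_zero_iff hP (hp.neg.add hP hp), isZero_add_comm hP]
  exact rel_refl hP hp

theorem mul_add_rel (hP : PrimeMatrixIdeal 𝒜 P)
    (hp : p.HasDegrees 𝒜 P α β ε δ) (hq : q.HasDegrees 𝒜 P α' β' δ η)
    (hr : r.HasDegrees 𝒜 P α'' β'' δ η) :
    Rel P (p.mul (q.add r)) ((p.mul q).add (p.mul r)) := by
  refine Rel.symm hP ?_
  refine rel_of_intertwine hP ((hp.mul hP hq).add hP (hp.mul hP hr))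
    (hp.mul hP (hq.add hP hr))
    (fromBlocks (fromCols 1 0) (fromCols 1 0) (fromBlocks 0 1 0 0) (fromBlocks 0 0 0 1))
    (fromBlocks (fromCols 1 0) (fromCols 1 0) (fromBlocks 0 1 0 0) (fromBlocks 0 0 0 1))
    ?_ ?_ ?_ ?_ ?_
  · simp
  · simp
  · simp [fromBlocks_multiply, fromCols_mul_fromBlocks, fromCols_add_fromCols,
      mul_fromCols]
  · simp [fromBlocks_mul_fromRows, fromRows_add_fromRows, fromCols_mul_fromRows]
  · simp [fromCols_mul_fromBlocks, mul_fromCols]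

theorem add_mul_rel (hP : PrimeMatrixIdeal 𝒜 P)
    (hp : p.HasDegrees 𝒜 P α β ε δ) (hq : q.HasDegrees 𝒜 P α' β' ε δ)
    (hr : r.HasDegrees 𝒜 P α'' β'' δ η) :
    Rel P ((p.add q).mul r) ((p.mul r).add (q.mul r)) := by
  refine rel_of_intertwine hP ((hp.add hP hq).mul hP hr)
    ((hp.mul hP hr).add hP (hq.mul hP hr))
    (fromBlocks (fromBlocks 1 0 0 0) (fromRows 0 1) (fromBlocks 0 1 0 0) (fromRows 0 1))
    (fromBlocks (fromBlocks 1 0 0 0) (fromRows 0 1) (fromBlocks 0 1 0 0) (fromRows 0 1))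
    ?_ ?_ ?_ ?_ ?_
  · simp
  · simp
  · simp [fromBlocks_multiply, fromBlocks_mul_fromRows, fromRows_add_fromRows, fromRows_mul]
  · simp [fromBlocks_mul_fromRows, fromRows_mul]
  · simp [fromCols_mul_fromBlocks, fromCols_add_fromCols, fromCols_mul_fromRows]

theorem mul_assoc_rel (hP : PrimeMatrixIdeal 𝒜 P) (hp : p.HasDegrees 𝒜 P α β ε δ)
    (hq : q.HasDegrees 𝒜 P α' β' δ η) (hr : r.HasDegrees 𝒜 P α'' β'' η ζ) :
    Rel P ((p.mul q).mul r) (p.mul (q.mul r)) := by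
  refine rel_of_intertwine hP ((hp.mul hP hq).mul hP hr) (hp.mul hP (hq.mul hP hr))
    (fromBlocks (fromCols 1 0) 0 (fromBlocks 0 1 0 0) (fromRows 0 1))
    (fromBlocks (fromCols 1 0) 0 (fromBlocks 0 1 0 0) (fromRows 0 1)) ?_ ?_ ?_ ?_ ?_
  · simp
  · simp
  · simp [fromBlocks_multiply, fromCols_mul_fromBlocks, fromBlocks_mul_fromRows, mul_fromCols,
      fromRows_mul, fromCols_mul_fromRows, fromRows_add_fromRows, fromCols_add_fromCols]
  · simp [fromBlocks_mul_fromRows, fromRows_mul]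
  · simp [fromCols_mul_fromBlocks, mul_fromCols]

theorem of_one_eq : (of fun _ _ => 1 : Matrix Unit Unit R) = 1 := by
  ext
  simp

theorem one_mul_rel [Nontrivial R] (hP : PrimeMatrixIdeal 𝒜 P)
    (hp : p.HasDegrees 𝒜 P α β ε δ) : Rel P ((ofRing 1).mul p) p := by
  have h1 : (ofRing (1 : R)).HasDegrees 𝒜 P (fun _ => ε) (fun _ => ε) ε ε :=
    hasDegrees_ofRing hP ε (by simpa using SetLike.one_mem_graded 𝒜)
  refine Rel.symm hP ?_
  refine rel_of_intertwine hP hp (h1.mul hP hp) (fromRows 0 1) (fromRows p.f 1) ?_ ?_ ?_ ?_ ?_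
  · simp
  · simp [hp.f]
  · simp [fromRows_mul, fromBlocks_mul_fromRows]
  · simp [fromRows_mul]
  · simp [fromCols_mul_fromRows, of_one_eq]

theorem mul_one_rel [Nontrivial R] (hP : PrimeMatrixIdeal 𝒜 P)
    (hp : p.HasDegrees 𝒜 P α β ε δ) : Rel P (p.mul (ofRing 1)) p := by
  have h1 : (ofRing (1 : R)).HasDegrees 𝒜 P (fun _ => δ) (fun _ => δ) δ δ :=
    hasDegrees_ofRing hP δ (by simpa using SetLike.one_mem_graded 𝒜)
  refine rel_of_intertwine hP (hp.mul hP h1) hp (fromCols 1 p.x) (fromCols 1 0) ?_ ?_ ?_ ?_ ?_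
  · simp [hp.x]
  · simp
  · simp [fromCols_mul_fromBlocks, mul_fromCols, of_one_eq]
  · simp [fromCols_mul_fromRows]
  · simp [mul_fromCols]

theorem ofRing_add_rel [Nontrivial R] (hP : PrimeMatrixIdeal 𝒜 P) {s t : R}
    (hs : s ∈ 𝒜 (ε - δ)) (ht : t ∈ 𝒜 (ε - δ)) :
    Rel P (ofRing (s + t)) ((ofRing s).add (ofRing t)) := by
  refine rel_of_intertwine hP (hasDegrees_ofRing hP δ (add_mem hs ht))
    ((hasDegrees_ofRing hP δ hs).add hP (hasDegrees_ofRing hP δ ht))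
    (fromRows 1 1) (fromRows 1 1) ?_ ?_ ?_ ?_ ?_
  · exact hasDeg_fromRows.2 ⟨hasDeg_one, hasDeg_one⟩
  · exact hasDeg_fromRows.2 ⟨hasDeg_one, hasDeg_one⟩
  · simp
  · simp
  · ext
    simp [fromCols_mul_fromRows]

theorem ofRing_mul_rel [Nontrivial R] (hP : PrimeMatrixIdeal 𝒜 P) {s t : R}
    (hs : s ∈ 𝒜 (ε - δ)) (ht : t ∈ 𝒜 (δ - η)) :
    Rel P (ofRing (s * t)) ((ofRing s).mul (ofRing t)) := by
  have hst : s * t ∈ 𝒜 (ε - η) := by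
    simpa using SetLike.mul_mem_graded hs ht
  refine rel_of_intertwine hP (hasDegrees_ofRing hP η hst)
    ((hasDegrees_ofRing hP δ hs).mul hP (hasDegrees_ofRing hP η ht))
    (fromRows 0 1) (fromRows (of fun _ _ => t) 1) ?_ ?_ ?_ ?_ ?_
  · simp
  · exact hasDeg_fromRows.2 ⟨fun _ _ => ht, hasDeg_one⟩
  · simp [fromBlocks_mul_fromRows]
  · simp
  · simp only [fromCols_mul_fromRows]
    ext
    simp [mul_apply]

theorem mul_inv_rel [Nontrivial R] (hP : PrimeMatrixIdeal 𝒜 P)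
    (hp : p.HasDegrees 𝒜 P α β ε δ) (h : ¬ p.IsZero P) :
    Rel P (p.mul p.inv) (ofRing 1) := by
  have h1 : (ofRing (1 : R)).HasDegrees 𝒜 P (fun _ => ε) (fun _ => ε) ε ε :=
    hasDegrees_ofRing hP ε (by simpa using SetLike.one_mem_graded 𝒜)
  -- The bordered system with right side `(0, -1)` has solution `(u, v)` with `p.f u = -1`, so the
  -- row `(-p.f, 0)` gives an expression for `1`. It links the product to `1`.
  have hY : Frac.HasDegrees 𝒜 P (p := ⟨p.ι ⊕ Unit, fromBlocks p.A p.x p.f 0, fromRows 0 (-1),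
      fromCols (-p.f) 0⟩) (Sum.elim α fun _ => ε) (Sum.elim β fun _ => δ) ε ε :=
    ⟨hp.bordered, by simp, by simp [hp.f], h⟩
  refine Rel.trans hP (hp.mul hP (hp.inv h)) hY h1 (Rel.symm hP ?_) ?_
  · refine rel_of_intertwine hP hY (hp.mul hP (hp.inv h))
      (fromRows (fromCols (-1) 0) 1) (fromRows (fromCols (-1) 0) 1) ?_ ?_ ?_ ?_ ?_
    · simp
    · simp
    · simp [fromRows_mul, fromBlocks_mul_fromRows, mul_fromCols, fromCols_mul_fromBlocks,
        fromCols_add_fromCols]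
    · simp [fromRows_mul, fromCols_mul_fromRows]
    · simp [fromCols_mul_fromRows, mul_fromCols]
  · refine rel_of_intertwine hP hY h1 (fromCols 0 (-1)) (fromCols (-p.f) 0) ?_ ?_ ?_ ?_ ?_
    · simp
    · simp [hp.f]
    · simp [fromCols_mul_fromBlocks]
    · simp [fromCols_mul_fromRows]
    · ext i (j | j) <;> simp [mul_apply]

/-- A column operation turns `(1 1; s 0)` into `(1 0; s -s)`, so membership in `P` would put the
identity or the `1 × 1` scalar matrix `s` into `P`. -/
theorem not_isZero_ofRing [Nontrivial R] (hP : PrimeMatrixIdeal 𝒜 P) {s : R} {γ : Γ}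
    (hs : s ∈ 𝒜 γ) (h0 : s ≠ 0) : ¬ (ofRing s).IsZero P := by
  intro h
  have hd : HasDeg 𝒜 (fun _ : Unit => γ) (fun _ : Unit => 0) (of fun _ _ => s) :=
    fun _ _ => by simpa using hs
  have h1 := hP.mul_right (α := Sum.elim (fun _ => 0) fun _ => γ)
    (β := Sum.elim (fun _ => 0) fun _ => 0) (γ := Sum.elim (fun _ => 0) fun _ => 0)
    (E := fromBlocks 1 (-1) 0 1) (hasDeg_fromBlocks.2 ⟨⟨hasDeg_one, hasDeg_one⟩, hd, hasDeg_zero⟩)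
    (hasDeg_fromBlocks.2 ⟨⟨hasDeg_one, hasDeg_one.neg⟩, hasDeg_zero, hasDeg_one⟩) h
  simp only [fromBlocks_multiply, Matrix.mul_one, Matrix.mul_neg, Matrix.mul_zero, add_zero,
    neg_add_cancel] at h1
  rcases (hP.lower_triangular_iff (α := fun _ => 0) hasDeg_one hd hd.neg).1 h1 with h2 | h2
  · exact hP.not_one h2
  · refine hP.proper Unit s ⟨γ, hs⟩ h0 ?_
    convert hP.neg h2 using 1
    ext
    simp

end Frac

end GrMat

namespace GrMat

/-! ### The graded components of the ring of fractions -/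

namespace Frac

variable {Γ : Type v} [AddGroup Γ] {R : Type u} [Ring R] {𝒜 : Γ → AddSubgroup R}
  {P : ∀ ι : Type, Matrix ι ι R → Prop}

/-- Representatives are normalized to have right degree `0`. In a product, the right degree of the
left factor must equal the left degree `δ` of the right factor, hence the translation. -/
theorem HasDegrees.shift {p : Frac R} {γ : Γ} {α β : p.ι → Γ} (h : p.HasDegrees 𝒜 P α β γ 0) (δ : Γ) :
    p.HasDegrees 𝒜 P (fun i => α i + δ) (fun i => β i + δ) (γ + δ) δ := by
  simpa using h.add_right δ

variable [SetLike.GradedMonoid 𝒜]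

/-- The identification of formal expressions of degree `γ`. -/
def setoid (hP : PrimeMatrixIdeal 𝒜 P) (γ : Γ) :
    Setoid {p : Frac R // ∃ α β, p.HasDegrees 𝒜 P α β γ 0} where
  r p q := Rel P p.1 q.1
  iseqv :=
    { refl := fun ⟨_, _, _, hp⟩ => rel_refl hP hp
      symm := fun h => h.symm hP
      trans := fun {p q r} h h' => by
        obtain ⟨p, _, _, hp⟩ := p
        obtain ⟨q, _, _, hq⟩ := q
        obtain ⟨r, _, _, hr⟩ := r
        exact h.trans hP hp hq hr h' }

/-- The component of degree `γ` of the graded division ring defined by a prime matrix ideal. -/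
def Component (hP : PrimeMatrixIdeal 𝒜 P) (γ : Γ) : Type (max 1 u) := Quotient (setoid hP γ)

namespace Component

variable (hP : PrimeMatrixIdeal 𝒜 P) {γ δ : Γ}

/-- The class of a formal expression of degree `γ`. -/
def mk (γ : Γ) (p : Frac R) (h : ∃ α β, p.HasDegrees 𝒜 P α β γ 0) : Component hP γ :=
  Quotient.mk (setoid hP γ) ⟨p, h⟩

variable {hP}

theorem mk_eq_mk {p q : Frac R} {h : ∃ α β, p.HasDegrees 𝒜 P α β γ 0}
    {h' : ∃ α β, q.HasDegrees 𝒜 P α β γ 0} : mk hP γ p h = mk hP γ q h' ↔ Rel P p q :=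
  Quotient.eq (r := setoid hP γ)

theorem exists_mk (a : Component hP γ) :
    ∃ (p : Frac R) (α β : p.ι → Γ) (h : p.HasDegrees 𝒜 P α β γ 0),
      a = mk hP γ p ⟨α, β, h⟩ := by
  induction a using Quotient.inductionOn with
  | h a =>
    obtain ⟨p, α, β, h⟩ := a
    exact ⟨p, α, β, h, rfl⟩

/-- Degrees such as `0 + γ` and `γ` are only propositionally equal, so the multiplicative axioms are
compared in `GradedMonoid`. -/
theorem graded_mk_eq {γ γ' : Γ} (hγ : γ = γ') {p q : Frac R}
    {h : ∃ α β, p.HasDegrees 𝒜 P α β γ 0} {h' : ∃ α β, q.HasDegrees 𝒜 P α β γ' 0}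
    (hpq : Rel P p q) :
    (⟨γ, mk hP γ p h⟩ : GradedMonoid (Component hP)) = ⟨γ', mk hP γ' q h'⟩ := by
  subst hγ
  rw [mk_eq_mk.2 hpq]

variable [Nontrivial R]

instance : Zero (Component hP γ) := ⟨mk hP γ (zero R) ⟨_, _, hasDegrees_zero hP _ _⟩⟩

instance : Add (Component hP γ) := ⟨Quotient.map₂
  (fun p q => ⟨p.1.add q.1, by
    obtain ⟨p, _, _, hp⟩ := p
    obtain ⟨q, _, _, hq⟩ := q
    exact ⟨_, _, hp.add hP hq⟩⟩)
  (by
    rintro ⟨p, _, _, hp⟩ ⟨p', _, _, hp'⟩ h ⟨q, _, _, hq⟩ ⟨q', _, _, hq'⟩ h'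
    exact Rel.add hP hp hq hp' hq' h h')⟩

instance : Neg (Component hP γ) := ⟨Quotient.map
  (fun p => ⟨p.1.neg, by
    obtain ⟨p, _, _, hp⟩ := p
    exact ⟨_, _, hp.neg⟩⟩)
  fun _ _ h => Rel.neg hP h⟩

/-- Multiplication of homogeneous elements. -/
def mul : Component hP γ → Component hP δ → Component hP (γ + δ) := Quotient.map₂
  (fun p q => ⟨p.1.mul q.1, by
    obtain ⟨p, _, _, hp⟩ := p
    obtain ⟨q, _, _, hq⟩ := q
    exact ⟨_, _, (HasDegrees.shift hp δ).mul hP hq⟩⟩)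
  (by
    rintro ⟨p, _, _, hp⟩ ⟨p', _, _, hp'⟩ h ⟨q, _, _, hq⟩ ⟨q', _, _, hq'⟩ h'
    exact Rel.trans hP ((HasDegrees.shift hp δ).mul hP hq)
      ((HasDegrees.shift hp' δ).mul hP hq) ((HasDegrees.shift hp' δ).mul hP hq')
      (Rel.mul_right hP (HasDegrees.shift hp δ) (HasDegrees.shift hp' δ) hq h)
      (Rel.mul_left hP (HasDegrees.shift hp' δ) hq hq' h'))

instance : AddCommGroup (Component hP γ) where
  nsmul := nsmulRec
  zsmul := zsmulRec
  add_assoc a b c := by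
    obtain ⟨p, _, _, hp, rfl⟩ := exists_mk a
    obtain ⟨q, _, _, hq, rfl⟩ := exists_mk b
    obtain ⟨r, _, _, hr, rfl⟩ := exists_mk c
    exact mk_eq_mk.2 (add_assoc_rel hP hp hq hr)
  zero_add a := by
    obtain ⟨p, _, _, hp, rfl⟩ := exists_mk a
    exact mk_eq_mk.2 (zero_add_rel hP hp)
  add_zero a := by
    obtain ⟨p, _, _, hp, rfl⟩ := exists_mk a
    exact mk_eq_mk.2 (Rel.trans hP (hp.add hP (hasDegrees_zero hP _ _))
      ((hasDegrees_zero hP _ _).add hP hp) hp (add_comm_rel hP hp (hasDegrees_zero hP _ _))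
      (zero_add_rel hP hp))
  neg_add_cancel a := by
    obtain ⟨p, _, _, hp, rfl⟩ := exists_mk a
    exact mk_eq_mk.2 (neg_add_rel hP hp)
  add_comm a b := by
    obtain ⟨p, _, _, hp, rfl⟩ := exists_mk a
    obtain ⟨q, _, _, hq, rfl⟩ := exists_mk b
    exact mk_eq_mk.2 (add_comm_rel hP hp hq)

theorem mk_eq_zero_iff {p : Frac R} {α β : p.ι → Γ} (h : p.HasDegrees 𝒜 P α β γ 0) :
    mk hP γ p ⟨α, β, h⟩ = 0 ↔ p.IsZero P :=
  mk_eq_mk.trans (rel_zero_iff hP h)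

variable (hP) in
/-- The canonical map from the component of degree `γ` of `R`. -/
def of (γ : Γ) : 𝒜 γ →+ Component hP γ :=
  AddMonoidHom.mk' (fun s => mk hP γ (ofRing s.1)
    ⟨_, _, hasDegrees_ofRing hP 0 (by simp)⟩) fun s t => mk_eq_mk.2
      (ofRing_add_rel hP (ε := γ) (δ := 0) (by simp) (by simp))

theorem of_ne_zero {s : 𝒜 γ} (h : s ≠ 0) : of hP γ s ≠ 0 := fun h0 =>
  not_isZero_ofRing hP s.2 (by simpa using h)
    ((mk_eq_zero_iff (hasDegrees_ofRing hP 0 (by simp))).1 h0)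

instance : GradedMonoid.GOne (Component hP) := ⟨of hP 0 ⟨1, SetLike.one_mem_graded 𝒜⟩⟩

instance : GradedMonoid.GMul (Component hP) := ⟨mul⟩

instance : DirectSum.GRing (Component hP) where
  mul_add a b c := by
    obtain ⟨p, _, _, hp, rfl⟩ := exists_mk a
    obtain ⟨q, _, _, hq, rfl⟩ := exists_mk b
    obtain ⟨r, _, _, hr, rfl⟩ := exists_mk c
    exact mk_eq_mk.2 (mul_add_rel hP (HasDegrees.shift hp _) hq hr)
  add_mul a b c := by
    obtain ⟨p, _, _, hp, rfl⟩ := exists_mk a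
    obtain ⟨q, _, _, hq, rfl⟩ := exists_mk b
    obtain ⟨r, _, _, hr, rfl⟩ := exists_mk c
    exact mk_eq_mk.2 (add_mul_rel hP (HasDegrees.shift hp _) (HasDegrees.shift hq _) hr)
  mul_zero {γ δ} a := by
    obtain ⟨p, _, _, hp, rfl⟩ := exists_mk a
    have h0 := hasDegrees_zero hP δ 0
    refine (mk_eq_zero_iff ((HasDegrees.shift hp _).mul hP h0)).2 ?_
    exact IsZero.mul_left hP (HasDegrees.shift hp _) h0
      ((rel_zero_iff hP h0).1 (rel_refl hP h0))
  zero_mul {γ δ} a := by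
    obtain ⟨p, _, _, hp, rfl⟩ := exists_mk a
    have h0 := hasDegrees_zero hP γ 0
    refine (mk_eq_zero_iff ((HasDegrees.shift h0 _).mul hP hp)).2 ?_
    exact IsZero.mul_right hP (HasDegrees.shift h0 _) hp
      ((rel_zero_iff hP h0).1 (rel_refl hP h0))
  one_mul := by
    rintro ⟨γ, a⟩
    obtain ⟨p, _, _, hp, rfl⟩ := exists_mk a
    exact graded_mk_eq (zero_add γ) (one_mul_rel hP hp)
  mul_one := by
    rintro ⟨γ, a⟩
    obtain ⟨p, _, _, hp, rfl⟩ := exists_mk a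
    exact graded_mk_eq (add_zero γ) (mul_one_rel hP hp)
  mul_assoc := by
    rintro ⟨γ, a⟩ ⟨δ, b⟩ ⟨ε, c⟩
    obtain ⟨p, _, _, hp, rfl⟩ := exists_mk a
    obtain ⟨q, _, _, hq, rfl⟩ := exists_mk b
    obtain ⟨r, _, _, hr, rfl⟩ := exists_mk c
    exact graded_mk_eq (add_assoc γ δ ε) (mul_assoc_rel hP
      ((HasDegrees.shift hp δ).add_right ε) (HasDegrees.shift hq ε) hr)
  natCast n := n • of hP 0 ⟨1, SetLike.one_mem_graded 𝒜⟩
  natCast_zero := zero_smul _ _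
  natCast_succ n := succ_nsmul _ _
  intCast n := n • of hP 0 ⟨1, SetLike.one_mem_graded 𝒜⟩
  intCast_ofNat n := natCast_zsmul _ _
  intCast_negSucc_ofNat n := negSucc_zsmul _ _

theorem exists_mul_eq_one {a : Component hP γ} (h : a ≠ 0) : ∃ b : Component hP (-γ),
    (⟨γ, a⟩ * ⟨-γ, b⟩ : GradedMonoid (Component hP)) = 1 := by
  obtain ⟨p, _, _, hp, rfl⟩ := exists_mk a
  rw [ne_eq, mk_eq_zero_iff hp] at h
  -- The inverse has left degree `0` and right degree `γ`; translation by `-γ` normalizes it.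
  have h1 := (hp.inv h).add_right (-γ)
  rw [zero_add, add_neg_cancel] at h1
  exact ⟨mk hP (-γ) p.inv ⟨_, _, h1⟩, graded_mk_eq (add_neg_cancel γ) (mul_inv_rel hP hp h)⟩

theorem of_one : of hP 0 ⟨1, SetLike.one_mem_graded 𝒜⟩ =
    (GradedMonoid.GOne.one : Component hP 0) := rfl

theorem of_mul (s : 𝒜 γ) (t : 𝒜 δ) : of hP (γ + δ) ⟨s * t, SetLike.mul_mem_graded s.2 t.2⟩ =
    GradedMonoid.GMul.mul (of hP γ s) (of hP δ t) :=
  mk_eq_mk.2 (ofRing_mul_rel hP (ε := γ + δ) (δ := δ) (η := 0) (by simp) (by simp))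

end Component

end Frac

end GrMat

namespace GrMat

open DirectSum

/-! ### External direct sums as internally graded rings -/

section OfRange

variable {Γ : Type*} [AddGroup Γ] [DecidableEq Γ] (X : Γ → Type*) [∀ γ, AddCommGroup (X γ)]

/-- The components of a direct sum, as subgroups. -/
def ofRange (γ : Γ) : AddSubgroup (⨁ γ, X γ) := (DirectSum.of X γ).range

/-- The isomorphism of `X γ` with the component of degree `γ` of the direct sum. -/
def toRange (γ : Γ) : X γ →+ ofRange X γ :=
  (DirectSum.of X γ).codRestrict (ofRange X γ) fun x => ⟨x, rfl⟩

variable [DirectSum.GRing X]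

instance : SetLike.GradedMonoid (ofRange X) where
  one_mem := ⟨GradedMonoid.GOne.one, rfl⟩
  mul_mem := by
    rintro γ δ _ _ ⟨x, rfl⟩ ⟨y, rfl⟩
    exact ⟨_, (DirectSum.of_mul_of x y).symm⟩

noncomputable instance : GradedRing (ofRange X) where
  toDecomposition := Decomposition.ofAddHom _
    (DirectSum.map (toRange X))
    (by
      ext γ x : 2
      change DirectSum.coeAddMonoidHom _ (DirectSum.map _ (DirectSum.of X γ x)) = _
      rw [DirectSum.map_of, DirectSum.coeAddMonoidHom_of]
      rfl)
    (by
      ext γ ⟨_, x, rfl⟩ : 2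
      change DirectSum.map _ (DirectSum.coeAddMonoidHom _ (DirectSum.of _ γ _)) = _
      rw [DirectSum.coeAddMonoidHom_of, DirectSum.map_of]
      rfl)

variable {X} {R : Type*} [Ring R] {𝒜 : Γ → AddSubgroup R} [GradedRing 𝒜]

/-- The homomorphism of graded rings with given components. -/
noncomputable def ofComponents (f : ∀ γ, 𝒜 γ →+ X γ)
    (hone : f 0 ⟨1, SetLike.one_mem_graded 𝒜⟩ = GradedMonoid.GOne.one)
    (hmul : ∀ {γ δ} (s : 𝒜 γ) (t : 𝒜 δ), f (γ + δ) ⟨s * t, SetLike.mul_mem_graded s.2 t.2⟩ =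
      GradedMonoid.GMul.mul (f γ s) (f δ t)) : 𝒜 →+*ᵍ ofRange X where
  toRingHom := (DirectSum.toSemiring (fun γ => (DirectSum.of X γ).comp (f γ))
    (by
      change DirectSum.of X 0 (f 0 ⟨1, SetLike.one_mem_graded 𝒜⟩) = _
      rw [hone]
      rfl)
    (fun {γ δ} s t => by
      change DirectSum.of X _ (f (γ + δ) ⟨s * t, SetLike.mul_mem_graded s.2 t.2⟩) = _
      rw [hmul]
      exact (DirectSum.of_mul_of _ _).symm)).comp (decomposeRingEquiv 𝒜).toRingHom
  map_mem {γ x} hx := by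
    refine ⟨f γ ⟨x, hx⟩, ?_⟩
    change _ = DirectSum.toAddMonoid _ (decompose 𝒜 x)
    rw [decompose_of_mem 𝒜 hx]
    simp

variable {f : ∀ γ, 𝒜 γ →+ X γ}
    {hone : f 0 ⟨1, SetLike.one_mem_graded 𝒜⟩ = GradedMonoid.GOne.one}
    {hmul : ∀ {γ δ} (s : 𝒜 γ) (t : 𝒜 δ), f (γ + δ) ⟨s * t, SetLike.mul_mem_graded s.2 t.2⟩ =
      GradedMonoid.GMul.mul (f γ s) (f δ t)}

theorem ofComponents_of_mem {γ : Γ} {x : R} (hx : x ∈ 𝒜 γ) :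
    ofComponents f hone hmul x = DirectSum.of X γ (f γ ⟨x, hx⟩) := by
  change DirectSum.toAddMonoid _ (decompose 𝒜 x) = _
  rw [decompose_of_mem 𝒜 hx]
  simp

theorem ofComponents_apply (x : R) (γ : Γ) :
    ofComponents f hone hmul x γ = f γ (decompose 𝒜 x γ) := by
  have : DirectSum.toAddMonoid (fun γ => (DirectSum.of X γ).comp (f γ)) = DirectSum.map f := by
    ext γ x : 2
    simp
  change (DirectSum.toAddMonoid (fun γ => (DirectSum.of X γ).comp (f γ)) (decompose 𝒜 x) :
    ⨁ γ, X γ) γ = _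
  rw [this, DirectSum.map_apply]

theorem ofComponents_injective (hf : ∀ γ, Function.Injective (f γ)) :
    Function.Injective (ofComponents f hone hmul) := by
  intro x y hxy
  refine (decompose 𝒜).injective (DFinsupp.ext fun γ => hf γ ?_)
  rw [← ofComponents_apply (hone := hone) (hmul := hmul),
    ← ofComponents_apply (hone := hone) (hmul := hmul), hxy]

end OfRange

/-! ### The division ring of a prime matrix ideal -/

section FromPrimeIdeal

variable {Γ : Type v} [AddGroup Γ] [DecidableEq Γ] {R : Type u} [Ring R] [Nontrivial R]
  {𝒜 : Γ → AddSubgroup R} [GradedRing 𝒜] {P : ∀ ι : Type, Matrix ι ι R → Prop}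

theorem isAlmostGradedRing_of_gradedRing {S : Type*} [Ring S] (𝒮 : Γ → AddSubgroup S)
    [GradedRing 𝒮] : IsAlmostGradedRing 𝒮 where
  gradedMonoid := inferInstance
  iSup_eq_top := by
    classical
    refine eq_top_iff.2 fun x _ => ?_
    rw [← sum_support_decompose 𝒮 x]
    exact sum_mem fun γ _ => le_iSup 𝒮 γ (SetLike.coe_mem _)

theorem IsGradedDivisionRing.isAlmostGradedDivisionRing {S : Type*} [Ring S]
    {𝒮 : Γ → AddSubgroup S} [GradedRing 𝒮] (h : IsGradedDivisionRing 𝒮) :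
    IsAlmostGradedDivisionRing 𝒮 where
  toIsAlmostGradedRing := isAlmostGradedRing_of_gradedRing 𝒮
  nontrivial := h.nontrivial
  exists_inv γ x hx hx0 := by
    obtain ⟨u, rfl⟩ := h.isUnit_of_ne_zero x ⟨γ, hx⟩ hx0
    -- Since `u` has degree `γ`, this is the degree `0` component of `u * u⁻¹ = 1`; hence `u⁻¹` is
    -- its own component of degree `-γ`.
    have h1 : (u : S) * (decompose 𝒮 ((u⁻¹ : Sˣ) : S) (-γ) : S) = 1 := by
      have := coe_decompose_mul_add_of_left_mem 𝒮 (j := -γ) (b := ((u⁻¹ : Sˣ) : S)) hx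
      rw [← this, add_neg_cancel, Units.mul_inv, decompose_of_mem_same 𝒮 (SetLike.one_mem_graded 𝒮)]
    have h2 : ((u⁻¹ : Sˣ) : S) = (decompose 𝒮 ((u⁻¹ : Sˣ) : S) (-γ) : S) :=
      (Units.inv_mul_eq_iff_eq_mul u).2 h1.symm |>.symm ▸ by simp
    refine ⟨((u⁻¹ : Sˣ) : S), ?_, by simp, by simp⟩
    rw [h2]
    exact SetLike.coe_mem _

theorem PrimeMatrixIdeal.exists_isAlmostGradedDivisionRing (hP : PrimeMatrixIdeal 𝒜 P) :
    ∃ (K : Type (max 1 u v)) (_ : Ring K) (𝒦 : Γ → AddSubgroup K) (φ : 𝒜 →+*ᵍ 𝒦),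
      IsAlmostGradedDivisionRing 𝒦 ∧
      ∀ x : R, SetLike.IsHomogeneousElem 𝒜 x → x ≠ 0 → φ x ≠ 0 := by
  let φ : 𝒜 →+*ᵍ ofRange (Frac.Component hP) :=
    ofComponents (Frac.Component.of hP) Frac.Component.of_one Frac.Component.of_mul
  have hφ : ∀ x : R, SetLike.IsHomogeneousElem 𝒜 x → x ≠ 0 → φ x ≠ 0 := by
    rintro x ⟨γ, hx⟩ hx0 h
    rw [ofComponents_of_mem hx] at h
    refine Frac.Component.of_ne_zero (hP := hP) (s := ⟨x, hx⟩) (by simpa using hx0) ?_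
    exact DirectSum.of_injective γ (h.trans (map_zero _).symm)
  refine ⟨⨁ γ, Frac.Component hP γ, inferInstance, _, φ, ?_, hφ⟩
  have hK : Nontrivial (⨁ γ, Frac.Component hP γ) :=
    nontrivial_of_ne _ _ (hφ 1 (SetLike.isHomogeneousElem_one 𝒜) one_ne_zero)
  have hinv : ∀ (γ : Γ) (x : ⨁ γ, Frac.Component hP γ), x ∈ ofRange (Frac.Component hP) γ →
      x ≠ 0 → ∃ y ∈ ofRange (Frac.Component hP) (-γ), x * y = 1 := by
    rintro γ _ ⟨x, rfl⟩ hx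
    obtain ⟨y, hy⟩ := Frac.Component.exists_mul_eq_one (a := x) fun h => hx (by simp [h])
    refine ⟨DirectSum.of _ _ y, ⟨y, rfl⟩, ?_⟩
    rw [DirectSum.of_mul_of]
    exact DirectSum.of_eq_of_gradedMonoid_eq hy
  refine ⟨isAlmostGradedRing_of_gradedRing _, hK, fun γ x hx hx0 => ?_⟩
  obtain ⟨y, hy, hxy⟩ := hinv γ x hx hx0
  -- The fraction calculus supplies only right inverses. The right inverse of `y` must be `x`, which
  -- makes `y` two-sided.
  obtain ⟨z, -, hyz⟩ := hinv (-γ) y hy fun h => by simp [h] at hxy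
  have : z = x := by rw [← one_mul z, ← hxy, mul_assoc, hyz, mul_one]
  exact ⟨y, hy, hxy, this ▸ hyz⟩

end FromPrimeIdeal

end GrMat

namespace GrMat

open DirectSum

/-! ### Transport of gradings along ring isomorphisms -/

section Transport

variable {Γ : Type*} [AddGroup Γ] {R : Type*} [Ring R] {𝒜 : Γ → AddSubgroup R}
  {K L : Type*} [Ring K] [Ring L]

/-- Inverses are unique, so an inverse formed in the division closure is the one of degree `-γ`
provided by `𝒦`. -/
theorem InDivisionClosure.mem {𝒦 : Γ → AddSubgroup K} (h : IsAlmostGradedDivisionRing 𝒦)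
    (φ : 𝒜 →+*ᵍ 𝒦) {γ : Γ} {x : K} (hx : InDivisionClosure 𝒜 φ.toRingHom γ x) : x ∈ 𝒦 γ := by
  have := h.gradedMonoid
  have := h.nontrivial
  induction hx with
  | map h => exact φ.map_mem h
  | add _ _ h1 h2 => exact add_mem h1 h2
  | neg _ h1 => exact neg_mem h1
  | mul _ _ h1 h2 => exact SetLike.mul_mem_graded h1 h2
  | @inv γ x y _ hxy hyx h1 =>
    obtain ⟨z, hz, hxz, -⟩ := h.exists_inv γ x h1 (by rintro rfl; simp at hxy)
    rwa [← left_inv_eq_right_inv hyx hxz] at hz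

theorem InDivisionClosure.map_ringEquiv {f : R →+* K} {g : R →+* L} (e : K ≃+* L)
    (hfg : ∀ r, g r = e (f r)) {γ : Γ} {x : K} (hx : InDivisionClosure 𝒜 f γ x) :
    InDivisionClosure 𝒜 g γ (e x) := by
  induction hx with
  | map h => exact hfg _ ▸ .map h
  | add _ _ h1 h2 => simpa using h1.add h2
  | neg _ h1 => simpa using h1.neg
  | mul _ _ h1 h2 => simpa using h1.mul h2
  | inv _ hxy hyx h1 =>
    exact h1.inv (by rw [← map_mul, hxy, map_one]) (by rw [← map_mul, hyx, map_one])

variable (𝒦 : Γ → AddSubgroup K)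

/-- The image of a grading under an isomorphism of rings. -/
def mapGrading (e : K ≃+* L) (γ : Γ) : AddSubgroup L := (𝒦 γ).map (e : K →+ L)

/-- The isomorphism of a component with its image. -/
def toMapGrading (e : K ≃+* L) (γ : Γ) : 𝒦 γ →+ mapGrading 𝒦 e γ :=
  ((e : K →+ L).comp (𝒦 γ).subtype).codRestrict (mapGrading 𝒦 e γ) fun x => ⟨x, x.2, rfl⟩

/-- The composition of a homomorphism of graded rings with an isomorphism. -/
def mapGradingHom (e : K ≃+* L) {𝒦 : Γ → AddSubgroup K} (φ : 𝒜 →+*ᵍ 𝒦) :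
    𝒜 →+*ᵍ mapGrading 𝒦 e where
  toRingHom := (e : K →+* L).comp φ.toRingHom
  map_mem {_ x} h := ⟨φ x, φ.map_mem h, rfl⟩

variable {𝒦} in
theorem IsGradedEpicDivisionRing.mapGrading {φ : 𝒜 →+*ᵍ 𝒦}
    (h : IsGradedEpicDivisionRing 𝒜 𝒦 φ) (e : K ≃+* L) :
    IsGradedEpicDivisionRing 𝒜 (mapGrading 𝒦 e) (mapGradingHom e φ) where
  isGradedDivisionRing :=
    { nontrivial := have := h.isGradedDivisionRing.nontrivial; e.injective.nontrivial
      isUnit_of_ne_zero := by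
        rintro _ ⟨γ, x, hx, rfl⟩ h0
        refine (h.isGradedDivisionRing.isUnit_of_ne_zero x ⟨γ, hx⟩ ?_).map e
        rintro rfl
        exact h0 (map_zero e) }
  divisionClosure_eq_top := by
    refine eq_top_iff.2 fun y _ => ?_
    obtain ⟨x, rfl⟩ := e.surjective y
    have hx : x ∈ divisionClosure 𝒜 φ.toRingHom := by simp [h.divisionClosure_eq_top]
    induction hx using AddSubgroup.closure_induction with
    | mem x hx =>
      obtain ⟨γ, hx⟩ := hx
      exact AddSubgroup.subset_closure ⟨γ, hx.map_ringEquiv e fun _ => rfl⟩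
    | zero => simp
    | add x y _ _ h1 h2 =>
      rw [map_add]
      exact add_mem (h1 trivial) (h2 trivial)
    | neg x _ h1 =>
      rw [map_neg]
      exact neg_mem (h1 trivial)

variable [DecidableEq Γ] [GradedRing 𝒦]

theorem gradedMonoid_mapGrading (e : K ≃+* L) : SetLike.GradedMonoid (mapGrading 𝒦 e) where
  one_mem := ⟨1, SetLike.one_mem_graded 𝒦, map_one e⟩
  mul_mem := by
    rintro γ δ _ _ ⟨x, hx, rfl⟩ ⟨y, hy, rfl⟩
    exact ⟨x * y, SetLike.mul_mem_graded hx hy, map_mul e x y⟩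

/-- The image of a graded ring under an isomorphism of rings is graded. -/
@[reducible]
noncomputable def gradedRingMapGrading (e : K ≃+* L) : GradedRing (mapGrading 𝒦 e) where
  toGradedMonoid := gradedMonoid_mapGrading 𝒦 e
  toDecomposition := Decomposition.ofAddHom _
    ((DirectSum.map (toMapGrading 𝒦 e)).comp
      ((decomposeAddEquiv 𝒦).toAddMonoidHom.comp (e.symm : L →+ K)))
    (by
      have : (DirectSum.coeAddMonoidHom (mapGrading 𝒦 e)).comp
          (DirectSum.map (toMapGrading 𝒦 e)) =
          (e : K →+ L).comp (DirectSum.coeAddMonoidHom 𝒦) := by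
        ext γ x : 2
        change DirectSum.coeAddMonoidHom _ (DirectSum.map _ (DirectSum.of (fun γ => 𝒦 γ) γ x)) =
          e (DirectSum.coeAddMonoidHom _ (DirectSum.of (fun γ => 𝒦 γ) γ x))
        rw [DirectSum.map_of, DirectSum.coeAddMonoidHom_of, DirectSum.coeAddMonoidHom_of]
        rfl
      rw [← AddMonoidHom.comp_assoc, this]
      ext x
      change e (DirectSum.coeAddMonoidHom 𝒦 (decompose 𝒦 (e.symm x))) = x
      rw [← e.apply_symm_apply x]
      exact congrArg e ((Decomposition.left_inv (ℳ := 𝒦) _).trans (by simp)))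
    (by
      ext γ ⟨_, x, hx, rfl⟩ : 2
      change DirectSum.map _ (decompose 𝒦
        (e.symm (DirectSum.coeAddMonoidHom _ (DirectSum.of _ γ _)))) = DirectSum.of _ γ _
      rw [DirectSum.coeAddMonoidHom_of]
      change DirectSum.map _ (decompose 𝒦 (e.symm (e x))) = _
      rw [e.symm_apply_apply, decompose_of_mem 𝒦 hx, DirectSum.map_of]
      rfl)

end Transport

/-! ### Size of a graded epic division ring -/

section Small

/-- Formal rational expressions. -/
inductive RatExpr (R : Type u) : Type u
  | of : R → RatExpr R
  | add : RatExpr R → RatExpr R → RatExpr R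
  | neg : RatExpr R → RatExpr R
  | mul : RatExpr R → RatExpr R → RatExpr R
  | inv : RatExpr R → RatExpr R

/-- The value of a rational expression. -/
noncomputable def RatExpr.eval {R : Type u} {K : Type w} [Ring R] [Ring K] (f : R →+* K) :
    RatExpr R → K
  | of r => f r
  | add a b => a.eval f + b.eval f
  | neg a => -a.eval f
  | mul a b => a.eval f * b.eval f
  | inv a => Ring.inverse (a.eval f)

/-- Every element is the value of some rational expression over `R`, and these expressions form a
type in the universe of `R`. -/
theorem IsGradedEpicDivisionRing.small {Γ : Type v} [AddGroup Γ] {R : Type u} [Ring R]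
    {𝒜 : Γ → AddSubgroup R} {K : Type w} [Ring K] {𝒦 : Γ → AddSubgroup K} {φ : 𝒜 →+*ᵍ 𝒦}
    (h : IsGradedEpicDivisionRing 𝒜 𝒦 φ) : Small.{u} K := by
  refine small_of_surjective (f := RatExpr.eval φ.toRingHom) fun x => ?_
  have hx : x ∈ divisionClosure 𝒜 φ.toRingHom := by simp [h.divisionClosure_eq_top]
  induction hx using AddSubgroup.closure_induction with
  | mem x hx =>
    obtain ⟨γ, hx⟩ := hx
    induction hx with
    | @map _ r _ => exact ⟨.of r, rfl⟩
    | add _ _ h1 h2 =>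
      obtain ⟨a, rfl⟩ := h1
      obtain ⟨b, rfl⟩ := h2
      exact ⟨.add a b, rfl⟩
    | neg _ h1 =>
      obtain ⟨a, rfl⟩ := h1
      exact ⟨.neg a, rfl⟩
    | mul _ _ h1 h2 =>
      obtain ⟨a, rfl⟩ := h1
      obtain ⟨b, rfl⟩ := h2
      exact ⟨.mul a b, rfl⟩
    | inv _ hxy hyx h1 =>
      obtain ⟨a, rfl⟩ := h1
      exact ⟨.inv a, Ring.inverse_unit ⟨_, _, hxy, hyx⟩⟩
  | zero => exact ⟨.of 0, map_zero φ.toRingHom⟩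
  | add x y _ _ h1 h2 =>
    obtain ⟨a, rfl⟩ := h1
    obtain ⟨b, rfl⟩ := h2
    exact ⟨.add a b, rfl⟩
  | neg x _ h1 =>
    obtain ⟨a, rfl⟩ := h1
    exact ⟨.neg a, rfl⟩

end Small

/-! ### From almost graded division rings to graded epic ones -/

section Epic

variable {Γ : Type v} [AddGroup Γ] [DecidableEq Γ] {R : Type u} [Ring R]
  {𝒜 : Γ → AddSubgroup R} [GradedRing 𝒜] {K : Type*} [Ring K]

/-- The components of the division closure. -/
def closureComponent (𝒜 : Γ → AddSubgroup R) (f : R →+* K) (γ : Γ) : AddSubgroup K where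
  carrier := {x | InDivisionClosure 𝒜 f γ x}
  add_mem' h h' := h.add h'
  zero_mem' := map_zero f ▸ .map (zero_mem _)
  neg_mem' h := h.neg

instance (f : R →+* K) : SetLike.GradedMonoid (closureComponent 𝒜 f) where
  one_mem := map_one f ▸ .map (SetLike.one_mem_graded 𝒜)
  mul_mem _ _ _ _ h h' := h.mul h'

/-- The components of the canonical map to the division closure. -/
def toClosureComponent (f : R →+* K) (γ : Γ) : 𝒜 γ →+ closureComponent 𝒜 f γ :=
  ((f : R →+ K).comp (𝒜 γ).subtype).codRestrict (closureComponent 𝒜 f γ) fun x => .map x.2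

/-- The components of the division closure may overlap inside `K`, but their external direct sum is
graded by construction. Inverses of nonzero homogeneous elements stay in the closure, and
injectivity can be tested on each component. -/
theorem IsAlmostGradedDivisionRing.exists_isGradedEpicDivisionRing
    {𝒦 : Γ → AddSubgroup K} (h : IsAlmostGradedDivisionRing 𝒦) (φ : 𝒜 →+*ᵍ 𝒦)
    (hφ : ∀ x : R, SetLike.IsHomogeneousElem 𝒜 x → x ≠ 0 → φ x ≠ 0) :
    ∃ (K : Type (max u w)) (_ : Ring K) (𝒦 : Γ → AddSubgroup K) (_ : GradedRing 𝒦)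
      (φ : 𝒜 →+*ᵍ 𝒦), IsGradedEpicDivisionRing 𝒜 𝒦 φ ∧ Function.Injective φ := by
  let D := closureComponent 𝒜 φ.toRingHom
  let ψ : 𝒜 →+*ᵍ ofRange (fun γ => D γ) :=
    ofComponents (X := fun γ => D γ) (toClosureComponent φ.toRingHom)
      (Subtype.ext (map_one φ.toRingHom)) fun s t => Subtype.ext (map_mul φ.toRingHom s.1 t.1)
  have hψ : Function.Injective ψ := by
    refine ofComponents_injective fun γ => (injective_iff_map_eq_zero _).2 fun s hs => ?_
    by_contra hs0
    exact hφ s ⟨γ, s.2⟩ (by simpa using hs0) (congrArg Subtype.val hs)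
  have hof : ∀ {γ : Γ} {x : K} (hx : x ∈ D γ),
      InDivisionClosure 𝒜 ψ.toRingHom γ (DirectSum.of (fun γ => D γ) γ ⟨x, hx⟩) := by
    intro γ x hx
    have hx' : InDivisionClosure 𝒜 φ.toRingHom γ x := hx
    induction hx' with
    | @map γ r hr =>
      have := InDivisionClosure.map (f := ψ.toRingHom) hr
      rwa [show ψ.toRingHom r = _ from ofComponents_of_mem hr] at this
    | add h1 h2 ih1 ih2 =>
      have := (ih1 h1).add (ih2 h2)
      rw [← map_add] at this
      exact this
    | neg h1 ih1 =>
      have := (ih1 h1).neg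
      rw [← map_neg] at this
      exact this
    | mul h1 h2 ih1 ih2 =>
      have := (ih1 h1).mul (ih2 h2)
      rw [DirectSum.of_mul_of] at this
      exact this
    | inv h1 hxy hyx ih1 =>
      refine (ih1 h1).inv ?_ ?_
      · rw [DirectSum.of_mul_of]
        exact DirectSum.of_eq_of_gradedMonoid_eq (Sigma.subtype_ext (add_neg_cancel _) hxy)
      · rw [DirectSum.of_mul_of]
        exact DirectSum.of_eq_of_gradedMonoid_eq (Sigma.subtype_ext (neg_add_cancel _) hyx)
  have hepic : IsGradedEpicDivisionRing 𝒜 (ofRange fun γ => D γ) ψ := by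
    have hone : (1 : K) ∈ D 0 := SetLike.one_mem_graded D
    have hK := h.nontrivial
    have hmul : ∀ {γ δ : Γ} (hγδ : γ + δ = 0) {x y : K} (hx : x ∈ D γ) (hy : y ∈ D δ), x * y = 1 →
        DirectSum.of (fun γ => D γ) γ ⟨x, hx⟩ * DirectSum.of (fun γ => D γ) δ ⟨y, hy⟩ = 1 := by
      intro γ δ hγδ x y hx hy hxy
      rw [DirectSum.of_mul_of]
      exact DirectSum.of_eq_of_gradedMonoid_eq (Sigma.subtype_ext hγδ hxy)
    refine ⟨⟨⟨1, 0, fun h => ?_⟩, ?_⟩, ?_⟩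
    · have := DirectSum.of_injective (β := fun γ => D γ) 0 (h.trans (map_zero _).symm)
      exact one_ne_zero (congrArg Subtype.val this)
    · rintro _ ⟨γ, ⟨x, hx⟩, rfl⟩ h0
      obtain ⟨y, -, hxy, hyx⟩ := h.exists_inv γ x (InDivisionClosure.mem h φ hx) (by
        rintro rfl
        exact h0 (map_zero _))
      have hy : y ∈ D (-γ) := InDivisionClosure.inv hx hxy hyx
      exact ⟨⟨_, _, hmul (add_neg_cancel γ) hx hy hxy, hmul (neg_add_cancel γ) hy hx hyx⟩, rfl⟩
    · refine eq_top_iff.2 fun x _ => ?_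
      induction x using DirectSum.induction_on with
      | zero => exact zero_mem _
      | of γ x => exact AddSubgroup.subset_closure ⟨γ, hof x.2⟩
      | add x y h1 h2 => exact add_mem (h1 trivial) (h2 trivial)
  -- The direct sum lives in a universe depending on `Γ` and `K`; being small, it is replaced by an
  -- isomorphic copy in the required universe.
  have := hepic.small
  have : Small.{max u w} (⨁ γ, D γ) := small_lift.{_, w, u} _
  let e : (⨁ γ, D γ) ≃+* Shrink.{max u w} (⨁ γ, D γ) := (Shrink.ringEquiv _).symm
  exact ⟨Shrink.{max u w} (⨁ γ, D γ), inferInstance, _, gradedRingMapGrading _ e,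
    mapGradingHom e ψ, hepic.mapGrading e, e.injective.comp hψ⟩

end Epic

end GrMat

namespace GrMat

open Matrix

/-! ### Linear algebra over almost graded division rings -/

section LinearAlgebra

variable {Γ : Type v} [AddGroup Γ] {S : Type u} [Ring S] {𝒮 : Γ → AddSubgroup S}

/-- An underdetermined homogeneous system of linear equations over an almost graded division ring
has a nonzero homogeneous solution. -/
theorem IsAlmostGradedDivisionRing.exists_mulVec_eq_zero (h : IsAlmostGradedDivisionRing 𝒮) :
    ∀ {m n : ℕ}, m < n → ∀ {α : Fin m → Γ} {β : Fin n → Γ} {A : Matrix (Fin m) (Fin n) S},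
      HasDeg 𝒮 α β A → ∃ (δ : Γ) (w : Fin n → S), (∀ j, w j ∈ 𝒮 (β j - δ)) ∧ w ≠ 0 ∧
        A *ᵥ w = 0 := by
  have := h.gradedMonoid
  have := h.nontrivial
  intro m
  induction m with
  | zero =>
    intro n hn α β A hA
    refine ⟨β ⟨0, hn⟩, Pi.single ⟨0, hn⟩ 1, fun j => ?_, by simp, Subsingleton.elim _ _⟩
    rcases eq_or_ne j ⟨0, hn⟩ with rfl | hj
    · simpa using SetLike.one_mem_graded 𝒮
    · simp [hj]
  | succ m ih =>
    intro n hn α β A hA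
    obtain ⟨n, rfl⟩ : ∃ k, n = k + 1 := ⟨n - 1, by omega⟩
    by_cases h0 : ∀ j, A 0 j = 0
    · obtain ⟨δ, w, hw, hw0, hAw⟩ := ih (n := n + 1) (by omega) (hA.submatrix Fin.succ id)
      refine ⟨δ, w, hw, hw0, funext fun i => ?_⟩
      refine Fin.cases ?_ (fun i => ?_) i
      · simp [mulVec, dotProduct, h0]
      · exact congrFun hAw i
    · push Not at h0
      obtain ⟨j₀, hj₀⟩ := h0
      -- Gaussian elimination with pivot `A 0 j₀`: the remaining rows give a smaller system, and row
      -- `0` then determines the coordinate `j₀`.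
      obtain ⟨b, hb, hab, hba⟩ := h.exists_inv _ _ (hA 0 j₀) hj₀
      rw [neg_sub] at hb
      have hA' : HasDeg 𝒮 (α ∘ Fin.succ) (β ∘ j₀.succAbove) (of fun i j =>
          A (Fin.succ i) (j₀.succAbove j) - A (Fin.succ i) j₀ * b * A 0 (j₀.succAbove j)) := by
        intro i j
        refine sub_mem (hA _ _) ?_
        have := SetLike.mul_mem_graded (SetLike.mul_mem_graded (hA i.succ j₀) hb)
          (hA 0 (j₀.succAbove j))
        simpa using this
      obtain ⟨δ, w, hw, hw0, hAw⟩ := ih (n := n) (by omega) hA'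
      refine ⟨δ, j₀.insertNth (-(b * ∑ j, A 0 (j₀.succAbove j) * w j)) w, fun j => ?_, ?_, ?_⟩
      · refine Fin.succAboveCases j₀ ?_ (fun j => ?_) j
        · rw [Fin.insertNth_apply_same, Finset.mul_sum]
          refine neg_mem (sum_mem fun j _ => ?_)
          have := SetLike.mul_mem_graded hb
            (SetLike.mul_mem_graded (hA 0 (j₀.succAbove j)) (hw j))
          simpa using this
        · rw [Fin.insertNth_apply_succAbove]
          exact hw j
      · intro hw'
        refine hw0 (funext fun j => ?_)
        have := congrFun hw' (j₀.succAbove j)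
        rwa [Fin.insertNth_apply_succAbove] at this
      · funext i
        rw [mulVec, dotProduct, Fin.sum_univ_succAbove _ j₀]
        simp only [Fin.insertNth_apply_same, Fin.insertNth_apply_succAbove, Pi.zero_apply]
        refine Fin.cases ?_ (fun i => ?_) i
        · rw [mul_neg, ← mul_assoc, hab, one_mul, neg_add_cancel]
        · have := congrFun hAw i
          simp only [mulVec, dotProduct, of_apply, sub_mul, Finset.sum_sub_distrib,
            Pi.zero_apply] at this
          rw [mul_neg, ← mul_assoc, Finset.mul_sum, neg_add_eq_sub]
          simpa only [mul_assoc] using this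

variable {n : ℕ} {α β : Fin n → Γ} {A B C : Matrix (Fin n) (Fin n) S}

/-- Prefixing `A` with a column of the identity gives an underdetermined system. Its solution has
nonzero first coordinate because `A` has trivial kernel, and rescaling yields a column of a right
inverse. -/
theorem IsAlmostGradedDivisionRing.exists_mul_eq_one (h : IsAlmostGradedDivisionRing 𝒮)
    (hA : HasDeg 𝒮 α β A) (hker : ∀ w, A *ᵥ w = 0 → w = 0) :
    ∃ B, HasDeg 𝒮 β α B ∧ A * B = 1 := by
  have := h.gradedMonoid
  have key : ∀ i₀, ∃ v : Fin n → S, (∀ j, v j ∈ 𝒮 (β j - α i₀)) ∧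
      ∀ i, ∑ j, A i j * v j = (1 : Matrix (Fin n) (Fin n) S) i i₀ := by
    intro i₀
    have hA' : HasDeg 𝒮 α (Fin.cons (α i₀) β : Fin (n + 1) → Γ)
        (of fun i => (Fin.cons ((1 : Matrix (Fin n) (Fin n) S) i i₀) (A i) : Fin (n + 1) → S)) := by
      intro i j
      refine Fin.cases ?_ (fun j => ?_) j
      · exact hasDeg_one i i₀
      · exact hA i j
    obtain ⟨δ, w, hw, hw0, hAw⟩ := h.exists_mulVec_eq_zero (Nat.lt_succ_self n) hA'
    have hrow : ∀ i, (1 : Matrix (Fin n) (Fin n) S) i i₀ * w 0 + ∑ j, A i j * w j.succ = 0 := by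
      intro i
      have := congrFun hAw i
      simpa [mulVec, dotProduct, Fin.sum_univ_succ] using this
    have hc : w 0 ≠ 0 := by
      intro hc
      refine hw0 (funext fun j => Fin.cases hc (fun j => ?_) j)
      refine congrFun (hker (fun j => w j.succ) (funext fun i => ?_)) j
      have := hrow i
      rw [hc, mul_zero, zero_add] at this
      exact this
    obtain ⟨c, hcm, hc1, -⟩ := h.exists_inv _ _ (hw 0) hc
    refine ⟨fun j => -(w j.succ * c), fun j => ?_, fun i => ?_⟩
    · have := SetLike.mul_mem_graded (hw j.succ) hcm
      refine neg_mem ?_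
      simpa using this
    · have := congrArg (· * c) (hrow i)
      simp only [add_mul, zero_mul, mul_assoc, hc1, mul_one, Finset.sum_mul] at this
      simp only [mul_neg, Finset.sum_neg_distrib]
      exact neg_eq_of_add_eq_zero_left this
  choose v hv hAv using key
  exact ⟨of fun j i => v i j, fun j i => hv i j, ext fun i i₀ => by simpa [mul_apply] using hAv i₀ i⟩

/-- A right inverse `B` also has trivial kernel, so it has a right inverse of its own, which must be
`A`. -/
theorem IsAlmostGradedDivisionRing.exists_inverse (h : IsAlmostGradedDivisionRing 𝒮)
    (hA : HasDeg 𝒮 α β A) (hker : ∀ w, A *ᵥ w = 0 → w = 0) :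
    ∃ B, HasDeg 𝒮 β α B ∧ A * B = 1 ∧ B * A = 1 := by
  obtain ⟨B, hB, hAB⟩ := h.exists_mul_eq_one hA hker
  obtain ⟨C, -, hBC⟩ := h.exists_mul_eq_one hB fun w hw => by
    rw [← one_mulVec w, ← hAB, ← mulVec_mulVec, hw, mulVec_zero]
  exact ⟨B, hB, hAB, left_inv_eq_right_inv hAB hBC ▸ hBC⟩

theorem IsAlmostGradedDivisionRing.exists_ker (h : IsAlmostGradedDivisionRing 𝒮)
    (hA : HasDeg 𝒮 α β A) (hu : ¬ IsUnit A) : ∃ w, w ≠ 0 ∧ A *ᵥ w = 0 := by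
  by_contra! hcon
  obtain ⟨B, -, hAB, hBA⟩ := h.exists_inverse hA fun w hw => by_contra fun h0 => hcon w h0 hw
  exact hu ⟨⟨A, B, hAB, hBA⟩, rfl⟩

theorem not_isUnit_of_mulVec_eq_zero {w : Fin n → S} (hw : w ≠ 0) (hA : A *ᵥ w = 0) :
    ¬ IsUnit A := by
  rintro ⟨u, rfl⟩
  refine hw ?_
  rw [← one_mulVec w, ← Units.inv_mul u, ← mulVec_mulVec, hA, mulVec_zero]

theorem IsAlmostGradedDivisionRing.eq_zero_of_mul_eq_zero (h : IsAlmostGradedDivisionRing 𝒮)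
    {γ : Γ} {t x : S} (ht : t ∈ 𝒮 γ) (ht0 : t ≠ 0) (hx : t * x = 0) : x = 0 := by
  obtain ⟨y, -, -, hy⟩ := h.exists_inv γ t ht ht0
  rw [← one_mul x, ← hy, mul_assoc, hx, mul_zero]

/-- If `C` had an inverse `D`, then after multiplication by `D` the matrices `A` and `B` would agree
with the identity outside one column or row. Being singular, both would have diagonal entry `0`
there, yet these entries add up to `1`. -/
theorem IsAlmostGradedDivisionRing.not_isUnit_of_isNabla (h : IsAlmostGradedDivisionRing 𝒮)
    (hABC : IsNabla 𝒮 A B C) (hA : ¬ IsUnit A) (hB : ¬ IsUnit B) : ¬ IsUnit C := by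
  have := h.gradedMonoid
  have := h.nontrivial
  intro hC
  obtain ⟨⟨α, β, hAd, hBd⟩, hABC⟩ := hABC
  change HasDeg 𝒮 α β A at hAd
  change HasDeg 𝒮 α β B at hBd
  have hCd : HasDeg 𝒮 α β C := by
    rcases hABC with ⟨j, -, rfl⟩ | ⟨i, -, rfl⟩
    · intro i k
      rw [updateCol_apply]
      split_ifs with hk
      exacts [hk ▸ add_mem (hAd _ _) (hBd _ _), hAd _ _]
    · intro k j
      rw [updateRow_apply]
      split_ifs with hk
      exacts [hk ▸ add_mem (hAd _ _) (hBd _ _), hAd _ _]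
  obtain ⟨D, hD, hCD, hDC⟩ := h.exists_inverse hCd fun w hw => by_contra fun h0 =>
    not_isUnit_of_mulVec_eq_zero h0 hw hC
  rcases hABC with ⟨j, hj, hCj⟩ | ⟨i, hi, hCi⟩
  · have key : ∀ M : Matrix (Fin n) (Fin n) S, HasDeg 𝒮 α β M → ¬ IsUnit M →
        (∀ i k, k ≠ j → M i k = C i k) → (D * M) j j = 0 := by
      intro M hM hMu hMC
      by_contra ht
      obtain ⟨w, hw0, hw⟩ := h.exists_ker hM hMu
      have h1 : ∀ i k, k ≠ j → (D * M) i k = (1 : Matrix (Fin n) (Fin n) S) i k := by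
        intro i k hk
        simp [← hDC, mul_apply, hMC _ k hk]
      have h2 : (D * M) *ᵥ w = 0 := by rw [← mulVec_mulVec, hw, mulVec_zero]
      have h3 : w j = 0 := by
        refine h.eq_zero_of_mul_eq_zero ((hD.mul hM) j j) ht ?_
        have h4 := congrFun h2 j
        rw [mulVec, dotProduct, Finset.sum_eq_single j] at h4
        · exact h4
        · intro k _ hk
          rw [h1 j k hk, one_apply_ne hk.symm, zero_mul]
        · simp
      refine hw0 ?_
      rw [← one_mulVec w, ← h2]
      funext i
      rw [mulVec, mulVec, dotProduct, dotProduct]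
      refine Finset.sum_congr rfl fun k _ => ?_
      by_cases hk : k = j
      · simp [hk, h3]
      · rw [h1 i k hk]
    have hAC : ∀ i k, k ≠ j → A i k = C i k := by
      intro i k hk
      simp [hCj, hk]
    have h5 : (D * A) j j + (D * B) j j = 1 := by
      have : (D * C) j j = 1 := by simp [hDC]
      rw [← this, mul_apply, mul_apply, mul_apply, ← Finset.sum_add_distrib]
      simp [hCj, mul_add]
    rw [key A hAd hA hAC, key B hBd hB fun i k hk => by rw [← hj i k hk, hAC i k hk]] at h5
    simp at h5
  -- For rows `D` acts on the right, and the vector killed by `M * D` is `C *ᵥ w`. If the diagonal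
  -- entry were nonzero, this vector would vanish, contradicting invertibility of `C`.
  · have key : ∀ M : Matrix (Fin n) (Fin n) S, HasDeg 𝒮 α β M → ¬ IsUnit M →
        (∀ k j, k ≠ i → M k j = C k j) → (M * D) i i = 0 := by
      intro M hM hMu hMC
      by_contra ht
      obtain ⟨w, hw0, hw⟩ := h.exists_ker hM hMu
      have h1 : ∀ k j, k ≠ i → (M * D) k j = (1 : Matrix (Fin n) (Fin n) S) k j := by
        intro k j hk
        simp [← hCD, mul_apply, hMC k _ hk]
      have h2 : (M * D) *ᵥ (C *ᵥ w) = 0 := by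
        rw [mulVec_mulVec, Matrix.mul_assoc, hDC, Matrix.mul_one, hw]
      have h3 : ∀ k, k ≠ i → (C *ᵥ w) k = 0 := by
        intro k hk
        have h4 := congrFun h2 k
        rw [mulVec, dotProduct, Finset.sum_congr rfl fun j _ => by rw [h1 k j hk]] at h4
        simpa [one_apply] using h4
      have h5 : (C *ᵥ w) i = 0 := by
        refine h.eq_zero_of_mul_eq_zero ((hM.mul hD) i i) ht ?_
        have h4 := congrFun h2 i
        rw [mulVec, dotProduct, Finset.sum_eq_single i] at h4
        · exact h4
        · intro k _ hk
          rw [h3 k hk, mul_zero]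
        · simp
      have h6 : C *ᵥ w = 0 := by
        funext k
        by_cases hk : k = i
        exacts [hk ▸ h5, h3 k hk]
      exact not_isUnit_of_mulVec_eq_zero hw0 h6 hC
    have hAC : ∀ k j, k ≠ i → A k j = C k j := by
      intro k j hk
      simp [hCi, hk]
    have h5 : (A * D) i i + (B * D) i i = 1 := by
      have : (C * D) i i = 1 := by simp [hCD]
      rw [← this, mul_apply, mul_apply, mul_apply, ← Finset.sum_add_distrib]
      simp [hCi, add_mul]
    rw [key A hAd hA hAC, key B hBd hB fun k j hk => by rw [← hi k j hk, hAC k j hk]] at h5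
    simp at h5

end LinearAlgebra

/-! ### Assembling the equivalence -/

section Main

variable {Γ : Type v} [AddGroup Γ] {R : Type u} [Ring R] {𝒜 : Γ → AddSubgroup R}

theorem IsDeterminantalSum.not_isUnit_map {K : Type*} [Ring K] {𝒦 : Γ → AddSubgroup K}
    (h : IsAlmostGradedDivisionRing 𝒦) (φ : 𝒜 →+*ᵍ 𝒦) {n : ℕ} {A : Matrix (Fin n) (Fin n) R}
    (hA : IsDeterminantalSum 𝒜 (nonGrFull 𝒜 n) A) : ¬ IsUnit (A.map φ) := by
  have hmap : ∀ {m n : ℕ} {α : Fin m → Γ} {β : Fin n → Γ} {M : Matrix (Fin m) (Fin n) R},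
      HasDegrees 𝒜 α β M → HasDeg 𝒦 α β (M.map φ) := fun h i j => φ.map_mem (h i j)
  induction hA with
  | of_mem hA =>
    have hA := hA.2
    simp only [IsGrFull, not_forall, not_le] at hA
    obtain ⟨r, α, β, ε, X, Y, hX, hY, rfl, hr⟩ := hA
    -- The factor `Y` has fewer rows than columns, so its image kills a nonzero vector, and hence so
    -- does the product.
    obtain ⟨δ, w, -, hw0, hw⟩ := h.exists_mulVec_eq_zero hr (hmap hY)
    refine not_isUnit_of_mulVec_eq_zero hw0 ?_
    have : (X * Y).map φ = X.map φ * Y.map φ := Matrix.map_mul (f := φ.toRingHom)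
    rw [this, ← mulVec_mulVec, hw, mulVec_zero]
  | nabla _ _ hABC h1 h2 =>
    refine h.not_isUnit_of_isNabla ?_ h1 h2
    obtain ⟨⟨α, β, hA, hB⟩, hABC⟩ := hABC
    refine ⟨⟨α, β, hmap hA, hmap hB⟩, hABC.imp ?_ ?_⟩
    · rintro ⟨j, hj, rfl⟩
      refine ⟨j, fun i k hk => congrArg φ (hj i k hk), ?_⟩
      ext i k
      simp only [map_apply, updateCol_apply]
      split_ifs <;> simp
    · rintro ⟨i, hi, rfl⟩
      refine ⟨i, fun k j hk => congrArg φ (hi k j hk), ?_⟩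
      ext k j
      simp only [map_apply, updateRow_apply]
      split_ifs <;> simp

theorem IsAlmostGradedDivisionRing.not_isDeterminantalSum_diagonal {K : Type*} [Ring K]
    {𝒦 : Γ → AddSubgroup K} (h : IsAlmostGradedDivisionRing 𝒦) (φ : 𝒜 →+*ᵍ 𝒦)
    (hφ : ∀ x : R, SetLike.IsHomogeneousElem 𝒜 x → x ≠ 0 → φ x ≠ 0) {n : ℕ} {d : Fin n → R}
    (hd : ∀ i, SetLike.IsHomogeneousElem 𝒜 (d i) ∧ d i ≠ 0) :
    ¬ IsDeterminantalSum 𝒜 (nonGrFull 𝒜 n) (diagonal d) := by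
  intro hD
  refine hD.not_isUnit_map h φ ?_
  have key : ∀ i, ∃ y, φ (d i) * y = 1 ∧ y * φ (d i) = 1 := by
    intro i
    obtain ⟨⟨γ, hγ⟩, h0⟩ := hd i
    obtain ⟨y, -, hy⟩ := h.exists_inv γ _ (φ.map_mem hγ) (hφ _ ⟨γ, hγ⟩ h0)
    exact ⟨y, hy⟩
  choose y hy hy' using key
  rw [diagonal_map (map_zero φ)]
  refine ⟨⟨diagonal (φ ∘ d), diagonal y, ?_, ?_⟩, rfl⟩ <;>
    simp [diagonal_mul_diagonal, Function.comp_def, hy, hy']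

variable [SetLike.GradedMonoid 𝒜]

theorem nonGrFull_two {γ δ : Γ} {a c y : R} (ha : a ∈ 𝒜 γ) (hc : c ∈ 𝒜 0) (hy : y ∈ 𝒜 δ)
    (hay : a * y = 0) : HasDegrees 𝒜 ![γ, 0] ![0, -δ] !![a * c, 0; c, y] ∧
      !![a * c, 0; c, y] ∈ nonGrFull 𝒜 2 := by
  have h1 : HasDegrees 𝒜 ![γ, 0] (fun _ => 0) !![a; 1] := by
    simp [HasDegrees, Fin.forall_fin_two, ha, SetLike.one_mem_graded 𝒜]
  have h2 : HasDegrees 𝒜 (fun _ => 0) ![0, -δ] !![c, y] := by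
    simp [HasDegrees, Fin.forall_fin_two, hc, hy]
  have h3 : !![a * c, 0; c, y] = !![a; 1] * !![c, y] := by
    ext i j
    fin_cases i <;> fin_cases j <;> simp [mul_apply, hay]
  have h4 : HasDegrees 𝒜 ![γ, 0] ![0, -δ] !![a * c, 0; c, y] := by
    rw [h3]
    exact HasDeg.mul h1 h2
  exact ⟨h4, ⟨_, _, h4⟩, fun h => by simpa using h 1 _ _ _ _ _ h1 h2 h3⟩

/-- If `xy = 0`, then `diag(x, y)` is the sum, in the first column, of `(x 0; 1 y)` and `(0 0; -1
y)`, which both factor through size `1`. -/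
theorem isGradedDomain_of_forall_not_isDeterminantalSum [Nontrivial R]
    (h : ∀ (n : ℕ) (d : Fin n → R), (∀ i, SetLike.IsHomogeneousElem 𝒜 (d i) ∧ d i ≠ 0) →
      ¬ IsDeterminantalSum 𝒜 (nonGrFull 𝒜 n) (diagonal d)) : IsGradedDomain 𝒜 where
  nontrivial := inferInstance
  eq_zero_or_eq_zero_of_mul_eq_zero x y hx hy hxy := by
    by_contra! hcon
    obtain ⟨γ, hγ⟩ := id hx
    obtain ⟨δ, hδ⟩ := id hy
    refine h 2 ![x, y] (by simp [Fin.forall_fin_two, hx, hy, hcon]) ?_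
    have h1 := nonGrFull_two hγ (SetLike.one_mem_graded 𝒜) hδ hxy
    -- Zero is regarded as an element of `𝒜 γ`, so that both matrices have the same degrees.
    have h2 := nonGrFull_two (zero_mem (𝒜 γ)) (neg_mem (SetLike.one_mem_graded 𝒜)) hδ
      (zero_mul y)
    refine .nabla (.of_mem h1.2) (.of_mem h2.2) ⟨⟨_, _, h1.1, h2.1⟩, Or.inl ⟨0, ?_, ?_⟩⟩
    · simp [Fin.forall_fin_two]
    · ext i j
      fin_cases i <;> fin_cases j <;> simp

/-- Block constructions need arbitrary index types, while the theorem speaks of `Fin n`; independent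
enumerations of rows and columns translate between the two. -/
theorem DetSum.isDeterminantalSum {ι : Type} {A : Matrix ι ι R} (h : DetSum 𝒜 ι A) {n : ℕ}
    (e f : Fin n ≃ ι) : IsDeterminantalSum 𝒜 (nonGrFull 𝒜 n) (A.submatrix e f) := by
  induction h with
  | of_nonFull h =>
    obtain ⟨κ, _, α, β, ε, X, Y, hc, hX, hY, rfl⟩ := h
    let g := (Fintype.equivFin κ).symm
    have h1 : HasDegrees 𝒜 (α ∘ e) (ε ∘ g) (X.submatrix e g) := hX.submatrix e g
    have h2 : HasDegrees 𝒜 (ε ∘ g) (β ∘ f) (Y.submatrix g f) := hY.submatrix g f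
    refine .of_mem ⟨⟨α ∘ e, β ∘ f, (hX.mul hY).submatrix e f⟩, fun hfull => ?_⟩
    have := hfull _ _ _ _ _ _ h1 h2 (submatrix_mul_equiv X Y e g f).symm
    rw [← Nat.card_congr e, Nat.card_fin] at hc
    omega
  | nabla j α β _ _ hA hB h1 h2 ih1 ih2 =>
    refine .nabla ih1 ih2 ⟨⟨α ∘ e, β ∘ f, hA.submatrix e f, hB.submatrix e f⟩,
      Or.inl ⟨f.symm j, fun i k hk => ?_, ?_⟩⟩
    · have := h2 (e i) (f k) (by rintro rfl; simp at hk)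
      exact this.1.symm.trans this.2
    · ext i k
      rw [updateCol_apply]
      split_ifs with hk
      · simp [hk, h1]
      · exact (h2 (e i) (f k) (by rintro rfl; simp at hk)).1

theorem properFamily_detSum (h : ∀ a : R, SetLike.IsHomogeneousElem 𝒜 a → a ≠ 0 → ∀ n : ℕ,
    ¬ IsDeterminantalSum 𝒜 (nonGrFull 𝒜 n) (a • (1 : Matrix (Fin n) (Fin n) R))) :
    ProperFamily 𝒜 (DetSum 𝒜) := by
  intro ι _ _ a ha ha0 hdet
  have := Fintype.ofFinite ι
  let e := (Fintype.equivFin ι).symm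
  refine h a ha ha0 (Fintype.card ι) ?_
  convert hdet.isDeterminantalSum e e using 1
  ext i j
  simp [one_apply]

end Main

end GrMat

theorem mainTheorem7 {Γ : Type v} [AddGroup Γ] [DecidableEq Γ] {R : Type u} [Ring R] [Nontrivial R]
    (𝒜 : Γ → AddSubgroup R) [GradedRing 𝒜] :
    List.TFAE [
      (∃ (K : Type (max u w)) (_ : Ring K) (𝒦 : Γ → AddSubgroup K) (_ : GradedRing 𝒦)
        (φ : 𝒜 →+*ᵍ 𝒦), GrMat.IsGradedEpicDivisionRing 𝒜 𝒦 φ ∧ Function.Injective φ),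
      (∃ (K : Type (max u w)) (_ : Ring K) (𝒦 : Γ → AddSubgroup K) (φ : 𝒜 →+*ᵍ 𝒦),
        GrMat.IsAlmostGradedDivisionRing 𝒦 ∧
        ∀ x : R, SetLike.IsHomogeneousElem 𝒜 x → x ≠ 0 → φ x ≠ 0),
      (GrMat.IsGradedDomain 𝒜 ∧
        ∀ a : R, SetLike.IsHomogeneousElem 𝒜 a → a ≠ 0 → ∀ n : ℕ,
          ¬ GrMat.IsDeterminantalSum 𝒜 (GrMat.nonGrFull 𝒜 n)
              (a • (1 : Matrix (Fin n) (Fin n) R))),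
      (∀ (n : ℕ) (d : Fin n → R), (∀ i, SetLike.IsHomogeneousElem 𝒜 (d i) ∧ d i ≠ 0) →
        ¬ GrMat.IsDeterminantalSum 𝒜 (GrMat.nonGrFull 𝒜 n) (Matrix.diagonal d))] := by
  tfae_have 1 → 2 := by
    rintro ⟨K, _, 𝒦, _, φ, hφ, hinj⟩
    exact ⟨K, inferInstance, 𝒦, φ, hφ.isGradedDivisionRing.isAlmostGradedDivisionRing,
      fun x _ hx h => hx (hinj (h.trans (map_zero φ).symm))⟩
  tfae_have 2 → 4 := by
    rintro ⟨K, _, 𝒦, φ, h, hφ⟩ n d hd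
    exact h.not_isDeterminantalSum_diagonal φ hφ hd
  tfae_have 4 → 3 := by
    intro h
    refine ⟨GrMat.isGradedDomain_of_forall_not_isDeterminantalSum h, fun a ha ha0 n => ?_⟩
    rw [Matrix.smul_one_eq_diagonal]
    exact h n _ fun _ => ⟨ha, ha0⟩
  tfae_have 3 → 1 := by
    rintro ⟨hR, h⟩
    obtain ⟨P, hP⟩ := GrMat.PrimeMatrixIdeal.exists_of_properFamily hR
      (GrMat.properFamily_detSum h)
    obtain ⟨K, _, 𝒦, φ, hK, hφ⟩ := hP.exists_isAlmostGradedDivisionRing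
    -- The ring of fractions may lie in too large a universe; passing to the division closure
    -- corrects this and provides generation by the image of `R`.
    exact hK.exists_isGradedEpicDivisionRing φ hφ
  tfae_finish
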